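/- **Theorem (Unconditional uniqueness).** Let $N\ge 1$ be an integer, let $d\in(0,1)$ or $d\in\{1,2,3,\dots\}$, and let $\alpha,p,\sigma$ be real numbers with $$-\alpha\in(0,2d),\qquad 2d<N,\qquad p>\frac{N+\alpha}{N-2d},\qquad -1<\sigma<0.$$ Put $p_c=\dfrac{N(p-1)}{2d+\alpha}$ and $\ell=\dfrac{Np_c}{N+2(\sigma+1)d\,p_c}$. Let $e^{-t(-\Delta)^d}$, $t>0$, be the semigroup generated by $-(-\Delta)^d$ on $\mathbb{R}^N$, that is, convolution with the kernel $E_d(\cdot,t)$ whose Fourier multiplier is $e^{-t|\xi|^{2d}}$. For real-valued $u_0\in L^{p_c}(\mathbb{R}^N)$ and $\mathbf{w}\in L^{\ell}(\mathbb{R}^N)$ consider the Duhamel equation $$u(t)=e^{-t(-\Delta)^d}u_0+\int_0^t e^{-(t-s)(-\Delta)^d}\big(|\cdot|^{\alpha}|u(s)|^p\big)\,ds+\int_0^t s^{\sigma}e^{-(t-s)(-\Delta)^d}\mathbf{w}\,ds,\qquad t\ge 0, \tag{D}$$ where for $t=0$ the equation means $u(0)=u_0$, and for each $t>0$ it is required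 that for almost every $x\in\mathbb{R}^N$ the integrals (over $y$, respectively over $(s,y)$, against the kernel $E_d$) converge absolutely and the identity holds. Then there is $\varepsilon>0$, depending only on $N,d,\alpha,p,\sigma$, such that the following holds for all $u_0\in L^{p_c}(\mathbb{R}^N)$ and $\mathbf{w}\in L^{\ell}(\mathbb{R}^N)$ with $\|u_0\|_{L^{p_c}}+\|\mathbf{w}\|_{L^{\ell}}<\varepsilon$: if $u$ and $v$ both belong to $C([0,\infty);L^{p_c}(\mathbb{R}^N))$ and both solve (D), then $u=v$ almost everywhere in $\mathbb{R}^N\times(0,\infty)$. -/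

import Mathlib

open MeasureTheory Set Filter Topology

/-- The kernel `E_d(x, t)` of the semigroup `exp (-t (-Δ)^d)` on `ℝ^N`: the inverse Fourier
transform of `ξ ↦ exp (-t |2πξ|^{2d})`. The factor `2π` belongs to the normalization
`e^{2πi⟨x,ξ⟩}` of the Fourier transform, for which `-Δ` has the symbol `|2πξ|^2`. The symbol is
even, so the inverse transform is real-valued and taking the real part is only a change of type. -/
noncomputable def polyheatKernel {N : ℕ} (d t : ℝ) (x : EuclideanSpace ℝ (Fin N)) : ℝ :=
  (FourierTransformInv.fourierInv
    (fun ξ : EuclideanSpace ℝ (Fin N) =>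
      ((Real.exp (-t * (2 * Real.pi * ‖ξ‖) ^ (2 * d)) : ℝ) : ℂ)) x).re

/-- The action `(exp (-t (-Δ)^d) f)(x) = (E_d(·, t) ∗ f)(x)` of the semigroup, for `t > 0`. -/
noncomputable def polyheat {N : ℕ} (d t : ℝ) (f : EuclideanSpace ℝ (Fin N) → ℝ)
    (x : EuclideanSpace ℝ (Fin N)) : ℝ :=
  ∫ y, polyheatKernel d t (x - y) * f y

/-- `u` is (a jointly measurable representative of) an element of `C([0, ∞); L^q(ℝ^N))`. -/
structure IsContinuousLpCurve {N : ℕ} (q : ENNReal)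
    (u : ℝ → EuclideanSpace ℝ (Fin N) → ℝ) : Prop where
  aestronglyMeasurable : AEStronglyMeasurable (fun z : ℝ × EuclideanSpace ℝ (Fin N) => u z.1 z.2)
    ((volume.restrict (Ioi (0 : ℝ))).prod volume)
  memLp : ∀ t, 0 ≤ t → MemLp (u t) q volume
  tendsto : ∀ t, 0 ≤ t →
    Tendsto (fun s => eLpNorm (fun x => u s x - u t x) q volume) (𝓝[Ici 0] t) (𝓝 0)

/-- `u` solves the integral (Duhamel) equation
`u(t) = e^{-t(-Δ)^d} u₀ + ∫₀ᵗ e^{-(t-s)(-Δ)^d} (|·|^α |u(s)|^p) ds + ∫₀ᵗ ζ(s) e^{-(t-s)(-Δ)^d} w ds`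
for all `t ≥ 0`: at `t = 0` it reads `u(0) = u₀`, and for every `t > 0` and almost every `x` the
integrals converge absolutely and the identity holds. -/
structure IsDuhamelSolution {N : ℕ} (d α p : ℝ) (ζ : ℝ → ℝ)
    (u₀ w : EuclideanSpace ℝ (Fin N) → ℝ) (u : ℝ → EuclideanSpace ℝ (Fin N) → ℝ) : Prop where
  initial : u 0 =ᵐ[volume] u₀
  integrable_data : ∀ t, 0 < t → ∀ᵐ x : EuclideanSpace ℝ (Fin N),
    Integrable (fun y => polyheatKernel d t (x - y) * u₀ y) volume
  integrable_nonlinear : ∀ t, 0 < t → ∀ᵐ x : EuclideanSpace ℝ (Fin N),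
    Integrable (fun z : ℝ × EuclideanSpace ℝ (Fin N) =>
        polyheatKernel d (t - z.1) (x - z.2) * (‖z.2‖ ^ α * |u z.1 z.2| ^ p))
      ((volume.restrict (Ioo 0 t)).prod volume)
  integrable_forcing : ∀ t, 0 < t → ∀ᵐ x : EuclideanSpace ℝ (Fin N),
    Integrable (fun z : ℝ × EuclideanSpace ℝ (Fin N) =>
        ζ z.1 * (polyheatKernel d (t - z.1) (x - z.2) * w z.2))
      ((volume.restrict (Ioo 0 t)).prod volume)
  duhamel : ∀ t, 0 < t → ∀ᵐ x : EuclideanSpace ℝ (Fin N),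
    u t x = polyheat d t u₀ x
      + (∫ s in Ioo 0 t, polyheat d (t - s) (fun y => ‖y‖ ^ α * |u s y| ^ p) x)
      + ∫ s in Ioo 0 t, ζ s * polyheat d (t - s) w x

/-!
# Unconditional uniqueness for a weighted polyharmonic heat equation at the critical exponent

The equation is critical in `C([0, ∞); L^q)`, `q = p_c`: the linear estimate behind a contraction
argument would need `∫₀ᵗ (t - s)⁻¹ ds`, which diverges. The way out is to measure everything in weak
`L^q`, uniformly in time. Let `F(s)` be bounded in weak `L^r`, `1 / r = 1 / q + 2d / N < 1`. By
Tonelli's theorem the integral of `∫₀ᵗ |E_d(t - s)| ∗ F(s) ds` over a set `S` of measure `m` equals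
`∫₀ᵗ ∫ F(s) h_{t-s} ds`, where `h_τ = |E_d(τ)| ∗ 1_S` is at most a constant times
`min 1 (τ ^ (-N / 2d) m)` and has mass at most a constant times `m`. Pairing weak `L^r` with
`L¹ ∩ L^∞` (`IsWeakLp.lintegral_mul_le`) bounds this by a constant times
`m ^ (1 - 1 / r) ∫₀^∞ min 1 (τ ^ (-N / 2d) m) ^ (1 / r) dτ`, and the last integral converges,
because `N / (2dr) > 1`, and is a multiple of `m ^ (2d / N)`. Hence the Duhamel integral lies in weak `L^q`
(`CriticalExponents.exists_nonlinear_le`, `isWeakLp_of_setLIntegral_le`). The weight `|y|^α` is in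
weak `L^(N / -α)`, so that Hölder's inequality in weak form (`IsWeakLp.mul₃`) supplies the bound on
`F = |y|^α |u|^(p - 1) |b|`.

With `b = u` this gives an a priori bound of `u(t)` in weak `L^q`, linear in the data and
superlinear in `u`; since `u` is continuous in time, a solution with small data stays small in weak
`L^q` for all times (`IsContinuousLpCurve.isWeakLp_of_improvement`). With `b = u - v` the same
estimate is a contraction for the difference of two solutions, both of which are small, so the
difference vanishes.

About the kernel only `sup_t ‖E_d(t)‖_{L¹} < ∞` and `‖E_d(t)‖_∞ ≤ C t ^ (-N / 2d)` are used. The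
first holds for every `d > 0`: Taylor's formula based at infinity (`exp_neg_rpow_eq_integral`)
writes `exp (-λ ^ d)` as a superposition of truncated powers `(1 - λ / s)₊ ^ k` with an integrable
density; for `λ = |ξ|²` these are dilates of one compactly supported multiplier of class `C^(k-1)`,
whose inverse Fourier transform is integrable when `k` is large, and dilation does not change the
`L¹` norm (`lintegral_enorm_fourierInv_superposition_le`).
-/

/-! ### Multipliers with integrable inverse Fourier transform -/

section Fourier

variable {V : Type*} [NormedAddCommGroup V] [InnerProductSpace ℝ V] [FiniteDimensional ℝ V]
  [MeasurableSpace V] [BorelSpace V]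

theorem contDiff_max_zero_pow (n : ℕ) : ContDiff ℝ n (fun x : ℝ => max 0 x ^ (n + 1)) := by
  induction n with
  | zero =>
    have : Continuous fun x : ℝ => max 0 x := by fun_prop
    simpa using (contDiff_zero (𝕜 := ℝ)).2 this
  | succ n ih =>
    have hd : ∀ x : ℝ, HasDerivAt (fun x : ℝ => max 0 x ^ (n + 2))
        (((n : ℝ) + 2) * max 0 x ^ (n + 1)) x := by
      have hne : ∀ y : ℝ, y ≠ 0 → HasDerivAt (fun x : ℝ => max 0 x ^ (n + 2))
          (((n : ℝ) + 2) * max 0 y ^ (n + 1)) y := by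
        intro y hy
        rcases lt_or_gt_of_ne hy with h | h
        · rw [max_eq_left h.le]
          have : (fun _ : ℝ => (0 : ℝ)) =ᶠ[𝓝 y] fun x : ℝ => max 0 x ^ (n + 2) := by
            filter_upwards [Iio_mem_nhds h] with x hx
            rw [max_eq_left (le_of_lt hx)]; simp
          simpa using (hasDerivAt_const y (0 : ℝ)).congr_of_eventuallyEq this.symm
        · rw [max_eq_right h.le]
          have : (fun x : ℝ => x ^ (n + 2)) =ᶠ[𝓝 y] fun x : ℝ => max 0 x ^ (n + 2) := by
            filter_upwards [Ioi_mem_nhds h] with x hx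
            rw [max_eq_right (le_of_lt hx)]
          simpa using (hasDerivAt_pow (n + 2) y).congr_of_eventuallyEq this.symm
      intro x
      by_cases hx : x = 0
      · subst hx
        refine hasDerivAt_of_hasDerivAt_of_ne (fun y hy => hne y hy) ?_ ?_
        · exact Continuous.continuousAt (by fun_prop)
        · exact Continuous.continuousAt (by fun_prop)
      · exact hne x hx
    have hderiv : deriv (fun x : ℝ => max 0 x ^ (n + 2))
        = fun x => ((n : ℝ) + 2) * max 0 x ^ (n + 1) := funext fun x => (hd x).deriv
    have : ((n + 1 : ℕ) : WithTop ℕ∞) = (n : WithTop ℕ∞) + 1 := by norm_cast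
    rw [this, contDiff_succ_iff_deriv]
    refine ⟨fun x => (hd x).differentiableAt, by simp, ?_⟩
    rw [hderiv]
    exact contDiff_const.mul ih

open FourierTransform

theorem continuous_fourierInv {f : V → ℂ} (hf : Integrable f) : Continuous (𝓕⁻ f) := by
  have : 𝓕⁻ f = fun x => 𝓕 f (-x) := funext fun x => Real.fourierInv_eq_fourier_neg f x
  rw [this]
  exact (VectorFourier.fourierIntegral_continuous Real.continuous_fourierChar
    (continuous_inner (𝕜 := ℝ) (E := V)) hf).comp continuous_neg

/-- Derivatives of a compactly supported function turn into decay of its inverse Fourier transform;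
`Measure.integrablePower` is an order of decay that suffices for integrability. -/
theorem integrable_fourierInv_of_contDiff {f : V → ℂ}
    (hf : ContDiff ℝ (volume : Measure V).integrablePower f) (hc : HasCompactSupport f) :
    Integrable (𝓕⁻ f) := by
  set P := (volume : Measure V).integrablePower
  have hfi : Integrable f := hf.continuous.integrable_of_hasCompactSupport hc
  have hint : ∀ (k n : ℕ), (k : ℕ∞) ≤ ((0 : ℕ) : ℕ∞) → (n : ℕ∞) ≤ (P : ℕ∞) →
      Integrable (fun v ↦ ‖v‖ ^ k * ‖iteratedFDeriv ℝ n f v‖) := by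
    intro k n _ hn
    have h1 : Continuous (fun v ↦ ‖v‖ ^ k * ‖iteratedFDeriv ℝ n f v‖) := by
      have := hf.continuous_iteratedFDeriv (m := n) (by exact_mod_cast hn)
      fun_prop
    exact h1.integrable_of_hasCompactSupport (hc.iteratedFDeriv n).norm.mul_left
  have hb : ∀ n ≤ P, ∃ C, ∀ x : V, ‖x‖ ^ n * ‖𝓕⁻ f x‖ ≤ C := by
    intro n hn
    refine ⟨(2 * Real.pi) ^ 0 * (2 * (0 : ℕ) + 2) ^ n * ∑ p ∈ Finset.range (0 + 1) ×ˢ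
      Finset.range (n + 1), ∫ v, ‖v‖ ^ p.1 * ‖iteratedFDeriv ℝ p.2 f v‖, fun x => ?_⟩
    have := Real.pow_mul_norm_iteratedFDeriv_fourier_le (by exact_mod_cast hf) hint
      (k := 0) (n := n) le_rfl (by exact_mod_cast hn) (-x)
    rwa [norm_iteratedFDeriv_zero, norm_neg, ← Real.fourierInv_eq_fourier_neg] at this
  obtain ⟨C₁, h₁⟩ := hb 0 (Nat.zero_le _)
  obtain ⟨C₂, h₂⟩ := hb P le_rfl
  have := integrable_of_le_of_pow_mul_le (μ := (volume : Measure V)) (k := 0)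
    (f := 𝓕⁻ f) (C₁ := C₁) (C₂ := C₂) (by simpa using h₁) (by simpa using h₂)
    (continuous_fourierInv hfi).aestronglyMeasurable
  simp only [pow_zero, one_mul] at this
  exact (integrable_norm_iff (continuous_fourierInv hfi).aestronglyMeasurable).1 this

theorem fourierInv_comp_smul (f : V → ℂ) {c : ℝ} (hc : 0 < c) (x : V) :
    𝓕⁻ (fun ξ => f (c • ξ)) x = (c ^ Module.finrank ℝ V)⁻¹ • 𝓕⁻ f (c⁻¹ • x) := by
  rw [Real.fourierInv_eq', Real.fourierInv_eq']
  have := Measure.integral_comp_smul (volume : Measure V) (fun v : V =>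
    Complex.exp ((↑(2 * Real.pi * inner ℝ v (c⁻¹ • x)) * Complex.I)) • f v) c
  rw [abs_of_pos (by positivity)] at this
  rw [← this]
  congr 1
  ext v
  have : inner ℝ (c • v) (c⁻¹ • x) = (inner ℝ v x : ℝ) := by
    rw [inner_smul_left, inner_smul_right]; simp; field_simp
  rw [this]

theorem lintegral_comp_smul_of_pos {g : V → ENNReal} (hg : AEMeasurable g) {c : ℝ} (hc : 0 < c) :
    ∫⁻ x, g (c • x) = ENNReal.ofReal ((c ^ Module.finrank ℝ V)⁻¹) * ∫⁻ x, g x := by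
  have hmap := Measure.map_addHaar_smul (volume : Measure V) hc.ne'
  rw [abs_of_pos (by positivity)] at hmap
  rw [← smul_eq_mul, ← lintegral_smul_measure, ← hmap, lintegral_map' _ (by fun_prop)]
  rw [hmap]
  exact hg.smul_measure _

theorem lintegral_enorm_fourierInv_comp_smul {f : V → ℂ} (hf : Integrable f) {c : ℝ}
    (hc : 0 < c) :
    ∫⁻ x, ‖𝓕⁻ (fun ξ => f (c • ξ)) x‖ₑ = ∫⁻ x, ‖𝓕⁻ f x‖ₑ := by
  have hcont := continuous_fourierInv hf
  simp_rw [fourierInv_comp_smul f hc, enorm_smul]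
  rw [lintegral_const_mul' _ _ (by simp),
    lintegral_comp_smul_of_pos (g := fun x => ‖𝓕⁻ f x‖ₑ) (by fun_prop) (inv_pos.2 hc),
    ← mul_assoc]
  have : ‖(c ^ Module.finrank ℝ V)⁻¹‖ₑ * ENNReal.ofReal ((c⁻¹ ^ Module.finrank ℝ V)⁻¹) = 1 := by
    rw [Real.enorm_of_nonneg (by positivity), ← ENNReal.ofReal_mul (by positivity)]
    rw [inv_pow, inv_inv, inv_mul_cancel₀ (by positivity), ENNReal.ofReal_one]
  rw [this, one_mul]

/-- A superposition of dilates of a multiplier: dilation does not change the `L¹` norm of the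
inverse Fourier transform, so Minkowski's inequality applies. -/
theorem lintegral_enorm_fourierInv_superposition_le {f : V → ℂ} (hf : Integrable f)
    (hF : Integrable (𝓕⁻ f)) {μ : Measure ℝ} [SFinite μ] {g : ℝ → ℂ} {c : ℝ → ℝ}
    (hc : ∀ᵐ s ∂μ, 0 < c s)
    (hint : Integrable (fun z : V × ℝ => g z.2 * f (c z.2 • z.1)) (volume.prod μ)) :
    ∫⁻ x, ‖𝓕⁻ (fun ξ => ∫ s, g s * f (c s • ξ) ∂μ) x‖ₑ
      ≤ (∫⁻ s, ‖g s‖ₑ ∂μ) * ∫⁻ x, ‖𝓕⁻ f x‖ₑ := by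
  have hm := hint.1
  have hexp : Continuous fun z : V × V =>
      Complex.exp (↑(2 * Real.pi * inner ℝ z.2 z.1) * Complex.I) := by fun_prop
  have hnorm : ∀ x ξ : V, ‖Complex.exp (↑(2 * Real.pi * inner ℝ ξ x) * Complex.I)‖ = 1 :=
    fun x ξ => Complex.norm_exp_ofReal_mul_I _
  have key : ∀ x : V, 𝓕⁻ (fun ξ => ∫ s, g s * f (c s • ξ) ∂μ) x
      = ∫ s, g s * 𝓕⁻ (fun ξ => f (c s • ξ)) x ∂μ := by
    intro x
    simp_rw [Real.fourierInv_eq', ← integral_const_mul, ← integral_smul]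
    rw [integral_integral_swap]
    · congr 1; ext s; congr 1; ext ξ
      simp only [smul_eq_mul]; ring
    · refine Integrable.mono' hint.norm ?_ (Eventually.of_forall fun z => ?_)
      · refine AEStronglyMeasurable.fun_smul ?_ hm
        exact (hexp.comp (by fun_prop : Continuous fun z : V × ℝ => (x, z.1))).aestronglyMeasurable
      · simp only [Function.uncurry, norm_smul, hnorm, one_mul, le_refl]
  have hmeas : AEMeasurable (fun z : V × ℝ => ‖g z.2 * 𝓕⁻ (fun ξ => f (c z.2 • ξ)) z.1‖ₑ)
      (volume.prod μ) := by
    have h1 : AEStronglyMeasurable (fun w : (V × ℝ) × V =>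
        Complex.exp (↑(2 * Real.pi * inner ℝ w.2 w.1.1) * Complex.I) •
          (g w.1.2 * f (c w.1.2 • w.2))) ((volume.prod μ).prod volume) := by
      refine AEStronglyMeasurable.fun_smul ?_ ?_
      · exact (hexp.comp
          (by fun_prop : Continuous fun w : (V × ℝ) × V => (w.1.1, w.2))).aestronglyMeasurable
      · refine hm.comp_quasiMeasurePreserving (f := fun w : (V × ℝ) × V => (w.2, w.1.2)) ?_
        exact (Measure.measurePreserving_swap.quasiMeasurePreserving).comp
          (MeasureTheory.QuasiMeasurePreserving.prodMap
            (Measure.quasiMeasurePreserving_snd (μ := (volume : Measure V)) (ν := μ))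
            (Measure.QuasiMeasurePreserving.id (volume : Measure V)))
    have h2 := h1.integral_prod_right'.enorm
    refine h2.congr (Eventually.of_forall fun z => ?_)
    simp_rw [Real.fourierInv_eq', ← integral_const_mul]
    congr 2; ext ξ
    simp only [smul_eq_mul]; ring
  calc ∫⁻ x, ‖𝓕⁻ (fun ξ => ∫ s, g s * f (c s • ξ) ∂μ) x‖ₑ
      ≤ ∫⁻ x : V, (∫⁻ s, ‖g s * 𝓕⁻ (fun ξ => f (c s • ξ)) x‖ₑ ∂μ) := by
        refine lintegral_mono fun x => ?_
        rw [key x]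
        exact enorm_integral_le_lintegral_enorm _
    _ = ∫⁻ s, (∫⁻ x : V, ‖g s * 𝓕⁻ (fun ξ => f (c s • ξ)) x‖ₑ) ∂μ := lintegral_lintegral_swap hmeas
    _ = ∫⁻ s, ‖g s‖ₑ * (∫⁻ x, ‖𝓕⁻ f x‖ₑ) ∂μ := by
        refine lintegral_congr_ae ?_
        filter_upwards [hc] with s hs
        simp_rw [enorm_mul]
        rw [lintegral_const_mul' _ _ (by simp), lintegral_enorm_fourierInv_comp_smul hf hs]
    _ = _ := lintegral_mul_const' _ _ hF.2.ne

end Fourier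

/-! ### A representation of `exp (-s ^ d)` by truncated powers -/

open Polynomial in
/-- The polynomials for which the `j`-th derivative of `s ↦ exp (-s ^ d)` is
`s ^ (-j) * P (s ^ d) * exp (-s ^ d)` on `s > 0`. -/
noncomputable def expRpowPoly (d : ℝ) : ℕ → Polynomial ℝ
  | 0 => 1
  | j + 1 => -(C (j : ℝ) * expRpowPoly d j) + C d * X * derivative (expRpowPoly d j)
      - C d * X * expRpowPoly d j

theorem X_dvd_expRpowPoly_succ (d : ℝ) (j : ℕ) : Polynomial.X ∣ expRpowPoly d (j + 1) := by
  induction j with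
  | zero => simp [expRpowPoly]
  | succ j ih =>
    rw [Polynomial.X_dvd_iff] at ih ⊢
    rw [expRpowPoly]
    simp [ih, mul_assoc]

theorem hasDerivAt_expRpowPoly (d : ℝ) (j : ℕ) {s : ℝ} (hs : 0 < s) :
    HasDerivAt (fun s : ℝ => (s ^ j)⁻¹ * (expRpowPoly d j).eval (s ^ d) * Real.exp (-s ^ d))
      ((s ^ (j + 1))⁻¹ * (expRpowPoly d (j + 1)).eval (s ^ d) * Real.exp (-s ^ d)) s := by
  have h1 : HasDerivAt (fun s : ℝ => s ^ d) (d * s ^ (d - 1)) s :=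
    Real.hasDerivAt_rpow_const (Or.inl hs.ne')
  have h2 : HasDerivAt (fun s : ℝ => (s ^ j)⁻¹) (-(j * s ^ (j - 1)) / (s ^ j) ^ 2) s :=
    (hasDerivAt_pow j s).inv (by positivity)
  have h3 : HasDerivAt (fun s : ℝ => (expRpowPoly d j).eval (s ^ d)) _ s :=
    HasDerivAt.comp (h₂ := fun y => (expRpowPoly d j).eval y) s
      ((expRpowPoly d j).hasDerivAt (s ^ d)) h1
  have h4 : HasDerivAt (fun s : ℝ => Real.exp (-s ^ d)) _ s := h1.fun_neg.exp
  refine ((h2.fun_mul h3).fun_mul h4).congr_deriv ?_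
  have hj : (j : ℝ) * s ^ (j - 1) = j * s ^ j / s := by
    rcases j with _ | j
    · simp
    · rw [pow_succ]; simp; field_simp
  rw [hj, Real.rpow_sub_one hs.ne', expRpowPoly]
  simp only [Polynomial.eval_add, Polynomial.eval_sub, Polynomial.eval_mul, Polynomial.eval_neg,
    Polynomial.eval_C, Polynomial.eval_X]
  field_simp
  ring

theorem integrableOn_rpow_mul_poly_mul_exp {d : ℝ} (hd : 0 < d) {a : ℝ} (ha : 0 ≤ a)
    {P : Polynomial ℝ} (hP : Polynomial.X ∣ P) :
    IntegrableOn (fun s : ℝ => s ^ (a - 1) * (P.eval (s ^ d) * Real.exp (-s ^ d))) (Ioi 0) := by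
  obtain ⟨Q, rfl⟩ := hP
  have : ∀ s ∈ Ioi (0 : ℝ), s ^ (a - 1) * ((Polynomial.X * Q).eval (s ^ d) * Real.exp (-s ^ d))
      = ∑ i ∈ Finset.range (Q.natDegree + 1),
        Q.coeff i * (s ^ (a - 1 + d + d * i) * Real.exp (-s ^ d)) := by
    intro s hs
    have hs : 0 < s := hs
    rw [Polynomial.eval_mul, Polynomial.eval_X, Polynomial.eval_eq_sum_range, Finset.mul_sum,
      Finset.sum_mul, Finset.mul_sum]
    refine Finset.sum_congr rfl fun i _ => ?_
    rw [Real.rpow_add hs, Real.rpow_add hs, Real.rpow_mul hs.le, Real.rpow_natCast]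
    ring
  refine IntegrableOn.congr_fun ?_ (fun s hs => (this s hs).symm) measurableSet_Ioi
  refine integrable_finsetSum _ fun i _ => Integrable.const_mul ?_ _
  refine integrableOn_rpow_mul_exp_neg_rpow ?_ hd
  have : 0 ≤ d * i := by positivity
  linarith

/-- Taylor's formula with base point at infinity, for `s ↦ exp (-s ^ d)`. -/
theorem exp_neg_rpow_eq_integral {d : ℝ} (hd : 0 < d) {k : ℕ} (hk : k ≠ 0) {x : ℝ}
    (hx : 0 < x) : Real.exp (-x ^ d) = ∫ s in Ioi (0 : ℝ), ((-1) ^ (k + 1) / k.factorial *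
      (s ^ ((0 : ℝ) - 1) * ((expRpowPoly d (k + 1)).eval (s ^ d) * Real.exp (-s ^ d))))
        * max 0 (1 - x / s) ^ k := by
  set f : ℕ → ℝ → ℝ := fun j s =>
    (s ^ j)⁻¹ * (expRpowPoly d j).eval (s ^ d) * Real.exp (-s ^ d) with hf
  -- The Taylor polynomial of order `k` based at `s`, evaluated at `x`: its derivative in `s`
  -- telescopes.
  set H : ℝ → ℝ := fun s => ∑ i ∈ Finset.range (k + 1),
    (-1) ^ i / i.factorial * ((s - x) ^ i * f i s) with hH
  have hderiv : ∀ s ∈ Ici x, HasDerivAt H ((-1) ^ k / k.factorial * ((s - x) ^ k * f (k + 1) s))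
      s := by
    intro s hs
    have hs0 : 0 < s := lt_of_lt_of_le hx hs
    have hf' : ∀ j, HasDerivAt (f j) (f (j + 1) s) s := fun j => hasDerivAt_expRpowPoly d j hs0
    clear_value f
    rw [hH]
    clear hH H hk
    induction k with
    | zero => simpa using hf' 0
    | succ k ih =>
      simp_rw [Finset.sum_range_succ _ (k + 1)]
      have h1 : HasDerivAt (fun s : ℝ => (s - x) ^ (k + 1)) (((k : ℝ) + 1) * (s - x) ^ k) s := by
        simpa using ((hasDerivAt_id s).sub_const x).fun_pow (k + 1)
      refine (ih.add ((h1.mul (hf' (k + 1))).const_mul _)).congr_deriv ?_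
      rw [Nat.factorial_succ]
      push_cast
      field_simp
      ring
  have hpow : ∀ i s, x < s → |(s - x) ^ i| ≤ s ^ i := fun i s hs => by
    rw [abs_of_nonneg (by have := sub_pos.2 hs; positivity)]
    have := sub_pos.2 hs
    gcongr
    linarith
  have hlim : Tendsto H atTop (𝓝 0) := by
    rw [hH, ← Finset.sum_const_zero (s := Finset.range (k + 1))]
    refine tendsto_finsetSum _ fun i _ => ?_
    rw [← mul_zero ((-1 : ℝ) ^ i / i.factorial)]
    refine Tendsto.const_mul _ ?_
    have h1 := ((expRpowPoly d i).tendsto_div_exp_atTop.comp (tendsto_rpow_atTop hd)).abs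
    rw [abs_zero] at h1
    refine squeeze_zero_norm' ?_ h1
    filter_upwards [Ioi_mem_atTop x] with s hs
    have hs0 : 0 < s := hx.trans hs
    rw [Real.norm_eq_abs, abs_mul, hf]
    calc |(s - x) ^ i| * |(s ^ i)⁻¹ * (expRpowPoly d i).eval (s ^ d) * Real.exp (-s ^ d)|
        ≤ s ^ i * |(s ^ i)⁻¹ * (expRpowPoly d i).eval (s ^ d) * Real.exp (-s ^ d)| := by
          gcongr; exact hpow i s hs
      _ = _ := by
          rw [mul_assoc, abs_mul, abs_of_pos (a := (s ^ i)⁻¹) (by positivity), ← mul_assoc,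
            mul_inv_cancel₀ (by positivity), one_mul, Real.exp_neg]
          simp [div_eq_mul_inv]
  have hint : IntegrableOn (fun s => (-1) ^ k / k.factorial * ((s - x) ^ k * f (k + 1) s))
      (Ioi x) := by
    refine Integrable.const_mul ?_ _
    have h1 := (integrableOn_rpow_mul_poly_mul_exp hd le_rfl
      (X_dvd_expRpowPoly_succ d k)).mono_set (Ioi_subset_Ioi hx.le)
    refine Integrable.mono h1 ?_ ?_
    · refine ContinuousOn.aestronglyMeasurable (fun s hs => ?_) measurableSet_Ioi
      refine ContinuousAt.continuousWithinAt ?_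
      exact ContinuousAt.mul (by fun_prop)
        (hasDerivAt_expRpowPoly d (k + 1) (hx.trans hs)).continuousAt
    · refine (ae_restrict_mem measurableSet_Ioi).mono fun s hs => ?_
      have hs0 : 0 < s := hx.trans hs
      rw [norm_mul, Real.norm_eq_abs]
      calc _ ≤ s ^ k * ‖f (k + 1) s‖ := by gcongr; exact hpow k s hs
        _ = _ := by
          rw [hf, zero_sub, Real.rpow_neg_one]
          simp only [norm_mul, norm_inv, norm_pow, Real.norm_of_nonneg hs0.le]
          field_simp
          ring
  have key := integral_Ioi_of_hasDerivAt_of_tendsto' hderiv hint hlim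
  have hHx : H x = Real.exp (-x ^ d) := by
    simp only [hH]
    rw [Finset.sum_eq_single 0]
    · simp [hf, expRpowPoly]
    · intro b _ hb; simp [hb]
    · simp
  rw [hHx] at key
  have : Real.exp (-x ^ d)
      = ∫ s in Ioi x, -((-1) ^ k / k.factorial * ((s - x) ^ k * f (k + 1) s)) := by
    rw [integral_neg, key]; ring
  rw [this, ← integral_indicator measurableSet_Ioi, ← integral_indicator measurableSet_Ioi]
  congr 1
  ext s
  by_cases h0 : 0 < s
  · by_cases hxs : x < s
    · rw [indicator_of_mem (by exact hxs), indicator_of_mem (by exact h0),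
        max_eq_right (by rw [sub_nonneg, div_le_one h0]; exact hxs.le), hf]
      have : s - x = s * (1 - x / s) := by field_simp
      rw [this, zero_sub, Real.rpow_neg_one]
      simp only []
      rw [mul_pow]
      field_simp
      ring
    · rw [indicator_of_notMem (by simpa using hxs), indicator_of_mem (by exact h0)]
      rw [max_eq_left (by rw [sub_nonpos, one_le_div h0]; exact not_lt.1 hxs)]
      simp [hk]
  · rw [indicator_of_notMem (by simp only [mem_Ioi]; linarith),
      indicator_of_notMem (by exact h0)]

/-! ### Bounds on the kernel -/

section Kernel

open FourierTransform

variable {N : ℕ}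

/-- The symbols at different times are dilates of one another. -/
theorem symbol_eq_comp_smul {d t : ℝ} (hd : 0 < d) (ht : 0 < t) :
    (fun ξ : EuclideanSpace ℝ (Fin N) =>
      ((Real.exp (-t * (2 * Real.pi * ‖ξ‖) ^ (2 * d)) : ℝ) : ℂ))
    = fun ξ => (fun ξ : EuclideanSpace ℝ (Fin N) =>
      ((Real.exp (-(2 * Real.pi * ‖ξ‖) ^ (2 * d)) : ℝ) : ℂ)) (t ^ (1 / (2 * d)) • ξ) := by
  ext ξ
  have : t * (2 * Real.pi * ‖ξ‖) ^ (2 * d)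
      = (2 * Real.pi * ‖t ^ (1 / (2 * d)) • ξ‖) ^ (2 * d) := by
    rw [norm_smul, Real.norm_of_nonneg (by positivity), mul_left_comm,
      Real.mul_rpow (x := t ^ (1 / (2 * d))) (by positivity) (by positivity),
      ← Real.rpow_mul ht.le]
    rw [one_div_mul_cancel (by positivity), Real.rpow_one]
  simp only [neg_mul, this]

theorem integrable_fourierInv_truncatedPower (N : ℕ) : ∃ k : ℕ, k ≠ 0 ∧
    Continuous (fun ξ : EuclideanSpace ℝ (Fin N) => max 0 (1 - ‖ξ‖ ^ 2) ^ k) ∧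
    Integrable (fun ξ : EuclideanSpace ℝ (Fin N) => max 0 (1 - ‖ξ‖ ^ 2) ^ k) ∧
    Integrable (𝓕⁻ (fun ξ : EuclideanSpace ℝ (Fin N) =>
      ((max 0 (1 - ‖ξ‖ ^ 2) ^ k : ℝ) : ℂ))) := by
  set n := (volume : Measure (EuclideanSpace ℝ (Fin N))).integrablePower
  have hcd : ContDiff ℝ n (fun ξ : EuclideanSpace ℝ (Fin N) => max 0 (1 - ‖ξ‖ ^ 2) ^ (n + 1)) :=
    (contDiff_max_zero_pow n).comp (contDiff_const.sub (contDiff_norm_sq ℝ))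
  have hcs : HasCompactSupport (fun ξ : EuclideanSpace ℝ (Fin N) =>
      max 0 (1 - ‖ξ‖ ^ 2) ^ (n + 1)) := by
    refine HasCompactSupport.intro (isCompact_closedBall 0 1) fun ξ hξ => ?_
    have : 1 < ‖ξ‖ := by simpa using hξ
    rw [max_eq_left (by nlinarith)]
    simp
  refine ⟨n + 1, by simp, hcd.continuous, hcd.continuous.integrable_of_hasCompactSupport hcs, ?_⟩
  refine integrable_fourierInv_of_contDiff (Complex.ofRealCLM.contDiff.comp hcd) ?_
  exact hcs.comp_left (g := fun x : ℝ => (x : ℂ)) (by simp)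

/-- The kernels `E_d(·, t)` are bounded in `L¹` uniformly in `t`: the symbol is a superposition of
dilates of a truncated power of `1 - ‖ξ‖²`, whose inverse Fourier transform is integrable. -/
theorem exists_lintegral_polyheatKernel_le (hN : 0 < N) {d : ℝ} (hd : 0 < d) :
    ∃ C : ℝ, 0 < C ∧ ∀ t, 0 < t →
      ∫⁻ x : EuclideanSpace ℝ (Fin N), ‖polyheatKernel d t x‖ₑ ≤ ENNReal.ofReal C := by
  obtain ⟨k, hk, hbc, hbi, hFb⟩ := integrable_fourierInv_truncatedPower N
  set b : EuclideanSpace ℝ (Fin N) → ℝ := fun ξ => max 0 (1 - ‖ξ‖ ^ 2) ^ k with hb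
  set g : ℝ → ℝ := fun s => (-1) ^ (k + 1) / k.factorial *
      (s ^ ((0 : ℝ) - 1) * ((expRpowPoly d (k + 1)).eval (s ^ d) * Real.exp (-s ^ d))) with hg
  have hgi : IntegrableOn g (Ioi 0) :=
    (integrableOn_rpow_mul_poly_mul_exp hd le_rfl (X_dvd_expRpowPoly_succ d k)).const_mul _
  set A := (∫⁻ s in Ioi (0 : ℝ), ‖(g s : ℂ)‖ₑ) * ∫⁻ x, ‖𝓕⁻ (fun ξ => (b ξ : ℂ)) x‖ₑ with hA
  have hAtop : A ≠ ⊤ := by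
    refine ENNReal.mul_ne_top ?_ hFb.2.ne
    exact hgi.ofReal (𝕜 := ℂ) |>.2.ne
  -- The summand `1` makes the constant positive.
  refine ⟨A.toReal + 1, by positivity, fun t ht => ?_⟩
  set r := 2 * Real.pi * t ^ (1 / (2 * d)) with hr
  have hr0 : 0 < r := by positivity
  set c : ℝ → ℝ := fun s => r * s ^ (-(1 / 2) : ℝ) with hc
  have hcpos : ∀ s, 0 < s → 0 < c s := fun s hs => by positivity
  have hint : Integrable (fun z : EuclideanSpace ℝ (Fin N) × ℝ =>
      (g z.2 : ℂ) * (b (c z.2 • z.1) : ℂ)) (volume.prod (volume.restrict (Ioi 0))) := by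
    have hcm : Measurable c := by fun_prop
    have hm : AEStronglyMeasurable (fun z : EuclideanSpace ℝ (Fin N) × ℝ =>
        (g z.2 : ℂ) * (b (c z.2 • z.1) : ℂ)) (volume.prod (volume.restrict (Ioi 0))) := by
      refine AEStronglyMeasurable.fun_mul ?_ ?_
      · exact (hgi.ofReal (𝕜 := ℂ)).1.comp_snd
      · refine (Complex.continuous_ofReal.measurable.comp
          (hbc.measurable.comp ?_)).aestronglyMeasurable
        fun_prop
    -- The integral over `ξ` costs a factor `s ^ (N / 2)`, absorbed by the exponential.
    rw [integrable_prod_iff' hm]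
    have hbs : ∀ s, 0 < s → Integrable fun ξ => (b (c s • ξ) : ℂ) := fun s hs =>
      (integrable_comp_smul_iff volume (fun ξ => (b ξ : ℂ)) (hcpos s hs).ne').2
        (hbi.ofReal (𝕜 := ℂ))
    refine ⟨(ae_restrict_mem measurableSet_Ioi).mono fun s hs =>
      (hbs s hs).const_mul (g s : ℂ), ?_⟩
    have hI : ∀ s ∈ Ioi (0 : ℝ), ∫ ξ, ‖(g s : ℂ) * (b (c s • ξ) : ℂ)‖
        = (r ^ N)⁻¹ * (∫ ξ, ‖(b ξ : ℂ)‖) * ‖(-1) ^ (k + 1) / k.factorial *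
          (s ^ ((N / 2 : ℝ) - 1) *
            ((expRpowPoly d (k + 1)).eval (s ^ d) * Real.exp (-s ^ d)))‖ := by
      intro s hs
      have hs : 0 < s := hs
      have h1 := Measure.integral_comp_smul (volume : Measure (EuclideanSpace ℝ (Fin N)))
        (fun ξ => ‖(b ξ : ℂ)‖) (c s)
      simp only [norm_mul, integral_const_mul]
      rw [h1, finrank_euclideanSpace_fin, abs_of_pos (by have := hcpos s hs; positivity), hg, hc]
      have h2 : s ^ ((N / 2 : ℝ) - 1) = ((s ^ (-(1 / 2) : ℝ)) ^ N)⁻¹ * s ^ ((0 : ℝ) - 1) := by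
        rw [← Real.rpow_natCast, ← Real.rpow_mul hs.le, ← Real.rpow_neg hs.le,
          ← Real.rpow_add hs]
        congr 1; ring
      rw [h2]
      simp only [Complex.norm_real, norm_mul, smul_eq_mul, mul_pow, mul_inv, norm_inv, norm_pow,
        Real.norm_of_nonneg (Real.rpow_nonneg hs.le _)]
      ring
    refine IntegrableOn.congr_fun ?_ (fun s hs => (hI s hs).symm) measurableSet_Ioi
    exact (((integrableOn_rpow_mul_poly_mul_exp hd (by positivity)
      (X_dvd_expRpowPoly_succ d k)).const_mul _).norm).const_mul _
  have hrep : (fun ξ : EuclideanSpace ℝ (Fin N) =>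
      ((Real.exp (-t * (2 * Real.pi * ‖ξ‖) ^ (2 * d)) : ℝ) : ℂ)) =ᵐ[volume]
      fun ξ => ∫ s in Ioi (0 : ℝ), (g s : ℂ) * (b (c s • ξ) : ℂ) := by
    have : Nontrivial (EuclideanSpace ℝ (Fin N)) := by
      have : Nonempty (Fin N) := ⟨⟨0, hN⟩⟩
      infer_instance
    -- Taylor's formula needs `ξ ≠ 0`, that is, `x > 0`.
    filter_upwards [measure_eq_zero_iff_ae_notMem.1
      (measure_singleton (μ := volume) (0 : EuclideanSpace ℝ (Fin N)))] with ξ hξ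
    have hξ0 : 0 < ‖ξ‖ := norm_pos_iff.2 (by simpa using hξ)
    have hx : 0 < r ^ 2 * ‖ξ‖ ^ 2 := by positivity
    have h1 : t * (2 * Real.pi * ‖ξ‖) ^ (2 * d) = (r ^ 2 * ‖ξ‖ ^ 2) ^ d := by
      have : r ^ 2 * ‖ξ‖ ^ 2 = ((2 * Real.pi * ‖ξ‖) * t ^ (1 / (2 * d))) ^ (2 : ℝ) := by
        rw [hr, Real.rpow_two]; ring
      rw [this, ← Real.rpow_mul (by positivity), Real.mul_rpow (y := t ^ (1 / (2 * d)))
        (by positivity) (by positivity), ← Real.rpow_mul ht.le,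
        one_div_mul_cancel (by positivity), Real.rpow_one, mul_comm]
    rw [neg_mul, h1, exp_neg_rpow_eq_integral hd hk hx, ← integral_complex_ofReal]
    refine setIntegral_congr_fun measurableSet_Ioi fun s hs => ?_
    have hs : 0 < s := hs
    have h2 : r ^ 2 * ‖ξ‖ ^ 2 / s = ‖c s • ξ‖ ^ 2 := by
      have h3 : (s ^ (-(1 / 2) : ℝ)) ^ 2 = s⁻¹ := by
        rw [← Real.rpow_natCast, ← Real.rpow_mul hs.le, ← Real.rpow_neg_one]
        norm_num
      rw [norm_smul, Real.norm_of_nonneg (hcpos s hs).le]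
      simp only [hc, mul_pow, h3]
      ring
    simp only [h2, hg, hb]
    push_cast
    ring
  have hsup := lintegral_enorm_fourierInv_superposition_le (hbi.ofReal (𝕜 := ℂ)) hFb
    (μ := volume.restrict (Ioi 0)) (g := fun s => (g s : ℂ)) (c := c)
    ((ae_restrict_mem measurableSet_Ioi).mono fun s hs => hcpos s hs) hint
  calc ∫⁻ x : EuclideanSpace ℝ (Fin N), ‖polyheatKernel d t x‖ₑ
      ≤ ∫⁻ x, ‖𝓕⁻ (fun ξ : EuclideanSpace ℝ (Fin N) =>
        ∫ s in Ioi (0 : ℝ), (g s : ℂ) * (b (c s • ξ) : ℂ)) x‖ₑ := by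
        refine lintegral_mono fun x => ?_
        have : 𝓕⁻ (fun ξ : EuclideanSpace ℝ (Fin N) =>
              ((Real.exp (-t * (2 * Real.pi * ‖ξ‖) ^ (2 * d)) : ℝ) : ℂ)) x
            = 𝓕⁻ (fun ξ : EuclideanSpace ℝ (Fin N) =>
              ∫ s in Ioi (0 : ℝ), (g s : ℂ) * (b (c s • ξ) : ℂ)) x := by
          rw [Real.fourierInv_eq', Real.fourierInv_eq']
          refine integral_congr_ae ?_
          filter_upwards [hrep] with ξ hξ
          rw [hξ]
        rw [polyheatKernel, this]
        rw [← ofReal_norm, ← ofReal_norm]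
        exact ENNReal.ofReal_le_ofReal (Complex.abs_re_le_norm _)
    _ ≤ A := hsup
    _ ≤ ENNReal.ofReal (A.toReal + 1) := by
        rw [← ENNReal.ofReal_toReal hAtop]
        exact ENNReal.ofReal_le_ofReal (by simp)

theorem exists_enorm_polyheatKernel_le {d : ℝ} (hd : 0 < d) :
    ∃ C : ℝ, 0 < C ∧ ∀ t, 0 < t → ∀ x : EuclideanSpace ℝ (Fin N),
      ‖polyheatKernel d t x‖ₑ ≤ ENNReal.ofReal (C * t ^ (-(N / (2 * d)))) := by
  set φ : EuclideanSpace ℝ (Fin N) → ℂ :=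
    fun ξ => ((Real.exp (-(2 * Real.pi * ‖ξ‖) ^ (2 * d)) : ℝ) : ℂ) with hφ
  refine ⟨(∫ ξ, ‖φ ξ‖) + 1, by positivity, fun t ht x => ?_⟩
  rw [← ofReal_norm]
  refine ENNReal.ofReal_le_ofReal ?_
  rw [polyheatKernel, symbol_eq_comp_smul hd ht]
  refine (Complex.abs_re_le_norm _).trans ?_
  rw [fourierInv_comp_smul φ (by positivity), norm_smul, Real.norm_of_nonneg (by positivity),
    mul_comm]
  have h1 : ‖𝓕⁻ φ ((t ^ (1 / (2 * d)))⁻¹ • x)‖ ≤ ∫ ξ, ‖φ ξ‖ := by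
    rw [Real.fourierInv_eq_fourier_neg]
    exact VectorFourier.norm_fourierIntegral_le_integral_norm _ _ _ _ _
  have h2 : ((t ^ (1 / (2 * d))) ^ Module.finrank ℝ (EuclideanSpace ℝ (Fin N)))⁻¹
      = t ^ (-(N / (2 * d))) := by
    rw [finrank_euclideanSpace_fin, ← Real.rpow_natCast, ← Real.rpow_mul ht.le,
      ← Real.rpow_neg ht.le]
    congr 1; ring
  rw [h2]
  gcongr
  linarith

theorem measurable_polyheatKernel (d : ℝ) :
    Measurable fun z : ℝ × EuclideanSpace ℝ (Fin N) => polyheatKernel d z.1 z.2 := by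
  unfold polyheatKernel
  simp_rw [Real.fourierInv_eq']
  refine Complex.measurable_re.comp (StronglyMeasurable.measurable ?_)
  refine StronglyMeasurable.integral_prod_right (f := fun (z : ℝ × EuclideanSpace ℝ (Fin N))
    (v : EuclideanSpace ℝ (Fin N)) => Complex.exp (↑(2 * Real.pi * inner ℝ v z.2) * Complex.I) •
      ((Real.exp (-z.1 * (2 * Real.pi * ‖v‖) ^ (2 * d)) : ℝ) : ℂ)) ?_
  refine Measurable.stronglyMeasurable ?_
  unfold Function.uncurry
  fun_prop

end Kernel

/-! ### Weak Lebesgue spaces -/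

/-- `F` lies in weak `L^r` with constant `A`: its distribution function is at most `(A / s) ^ r`.
Only the upper level sets of `F` enter, so the notion is meant for `F ≥ 0`. -/
def IsWeakLp {X : Type*} [MeasurableSpace X] (μ : Measure X) (r A : ℝ) (F : X → ℝ) : Prop :=
  ∀ s, 0 < s → μ {x | s < F x} ≤ ENNReal.ofReal ((A / s) ^ r)

section WeakLp

variable {X : Type*} [MeasurableSpace X] {μ : Measure X} {r A : ℝ} {F G : X → ℝ}

theorem IsWeakLp.mono (hF : IsWeakLp μ r A F) (hr : 0 ≤ r) (hA : 0 ≤ A) {B : ℝ} (hAB : A ≤ B)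
    (hGF : ∀ x, G x ≤ F x) : IsWeakLp μ r B G := by
  intro s hs
  refine (measure_mono fun x hx => lt_of_lt_of_le hx (hGF x)).trans ((hF s hs).trans ?_)
  refine ENNReal.ofReal_le_ofReal ?_
  gcongr

theorem isWeakLp_of_eLpNorm_le {f : X → ℝ} (hr : 0 < r) (hA : 0 ≤ A)
    (hf : AEStronglyMeasurable f μ) (h : eLpNorm f (ENNReal.ofReal r) μ ≤ ENNReal.ofReal A) :
    IsWeakLp μ r A (fun x => |f x|) := by
  intro s hs
  have h1 := meas_ge_le_mul_pow_eLpNorm_enorm μ (p := ENNReal.ofReal r) (by simpa using hr)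
    ENNReal.ofReal_ne_top hf (ε := ENNReal.ofReal s) (by simpa using hs) (by simp)
  rw [ENNReal.toReal_ofReal hr.le] at h1
  refine (measure_mono fun x hx => ?_).trans (h1.trans ?_)
  · have : s < |f x| := hx
    simp only [mem_ofPred_eq]
    rw [← ofReal_norm, Real.norm_eq_abs]
    exact ENNReal.ofReal_le_ofReal this.le
  · rw [div_eq_mul_inv, Real.mul_rpow hA (by positivity), mul_comm,
      ENNReal.ofReal_mul (by positivity), ← ENNReal.ofReal_inv_of_pos hs,
      ENNReal.ofReal_rpow_of_nonneg (by positivity) hr.le]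
    gcongr
    rw [← ENNReal.ofReal_rpow_of_nonneg hA hr.le]
    gcongr

theorem measure_lt_union_le (hr : 1 ≤ r) {B : ℝ} (hB : 0 ≤ B) {s : ℝ} (hs : 0 < s) {S T U : Set X}
    (hU : U ⊆ S ∪ T) (hS : μ S ≤ ENNReal.ofReal ((B / s) ^ r))
    (hT : μ T ≤ ENNReal.ofReal ((B / s) ^ r)) : μ U ≤ ENNReal.ofReal ((2 * B / s) ^ r) := by
  refine (measure_mono hU).trans ((measure_union_le _ _).trans ((add_le_add hS hT).trans ?_))
  rw [← two_mul, ← ENNReal.ofReal_ofNat, ← ENNReal.ofReal_mul (by norm_num)]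
  refine ENNReal.ofReal_le_ofReal ?_
  rw [mul_div_assoc, Real.mul_rpow (x := 2) (by norm_num) (by positivity)]
  gcongr
  exact Real.self_le_rpow_of_one_le (by norm_num) hr

theorem IsWeakLp.max (hr : 1 ≤ r) (hA : 0 ≤ A) (hF : IsWeakLp μ r A F) (hG : IsWeakLp μ r A G) :
    IsWeakLp μ r (2 * A) (fun x => max (F x) (G x)) := fun s hs =>
  measure_lt_union_le hr hA hs (S := {x | s < F x}) (T := {x | s < G x})
    (fun x (hx : s < Max.max (F x) (G x)) => (lt_max_iff.1 hx : s < F x ∨ s < G x))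
    (hF s hs) (hG s hs)

theorem IsWeakLp.abs_add {f g : X → ℝ} (hr : 1 ≤ r) (hA : 0 ≤ A)
    (hf : IsWeakLp μ r A (fun x => |f x|)) (hg : IsWeakLp μ r A (fun x => |g x|)) :
    IsWeakLp μ r (4 * A) (fun x => |f x + g x|) := by
  intro s hs
  have h2 : A / (s / 2) = (2 * A) / s := by field_simp
  have := measure_lt_union_le (μ := μ) (U := {x | s < |f x + g x|}) hr (B := 2 * A)
    (by positivity) hs ?_ (h2 ▸ hf (s / 2) (by positivity)) (h2 ▸ hg (s / 2) (by positivity))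
  · rwa [← mul_assoc, show (2 : ℝ) * 2 = 4 by norm_num] at this
  · intro x hx
    have hx : s < |f x + g x| := hx
    by_contra h
    simp only [mem_union, mem_ofPred_eq, not_or, not_lt] at h
    linarith [_root_.abs_add_le (f x) (g x)]

theorem IsWeakLp.abs_sub {f g : X → ℝ} (hr : 1 ≤ r) (hA : 0 ≤ A)
    (hf : IsWeakLp μ r A (fun x => |f x|)) (hg : IsWeakLp μ r A (fun x => |g x|)) :
    IsWeakLp μ r (4 * A) (fun x => |f x - g x|) := by
  have := hf.abs_add (g := fun x => -g x) hr hA (by simpa using hg)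
  simpa [sub_eq_add_neg] using this

/-- Hölder's inequality for three factors, in weak form: at the level `s` the three thresholds are
chosen so that each of the three level sets has measure at most `(A B D / s) ^ r`. -/
theorem IsWeakLp.mul₃ {a b c κ B D : ℝ} {H : X → ℝ} (ha : 0 < a) (hb : 0 < b) (hc : 0 < c)
    (hκ : 0 < κ) (hr : 1 ≤ r) (hsum : 1 / r = 1 / a + κ / b + 1 / c)
    (hA : 0 < A) (hB : 0 < B) (hD : 0 < D) (hG0 : ∀ x, 0 ≤ G x) (hH0 : ∀ x, 0 ≤ H x)
    (hF : IsWeakLp μ a A F) (hG : IsWeakLp μ b B G) (hH : IsWeakLp μ c D H) :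
    IsWeakLp μ r (3 * (A * B ^ κ * D)) (fun x => F x * G x ^ κ * H x) := by
  intro s hs
  have hr0 : 0 < r := by linarith
  set P := A * B ^ κ * D with hP
  have hP0 : 0 < P := by positivity
  set m := (P / s) ^ r with hm
  have hm0 : 0 < m := by positivity
  have h1 := hF (A * m ^ (-(1 / a))) (by positivity)
  have h2 := hG (B * m ^ (-(1 / b))) (by positivity)
  have h3 := hH (D * m ^ (-(1 / c))) (by positivity)
  have hred : ∀ (A a : ℝ), 0 < A → 0 < a → (A / (A * m ^ (-(1 / a)))) ^ a = m := by
    intro A a hA ha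
    rw [Real.rpow_neg hm0.le, ← div_eq_mul_inv, div_div_cancel₀ hA.ne', ← Real.rpow_mul hm0.le,
      one_div_mul_cancel ha.ne', Real.rpow_one]
  rw [hred _ _ hA ha] at h1
  rw [hred _ _ hB hb] at h2
  rw [hred _ _ hD hc] at h3
  have hprod : (A * m ^ (-(1 / a))) * (B * m ^ (-(1 / b))) ^ κ * (D * m ^ (-(1 / c))) = s := by
    rw [Real.mul_rpow hB.le (by positivity), ← Real.rpow_mul hm0.le]
    have : A * m ^ (-(1 / a)) * (B ^ κ * m ^ (-(1 / b) * κ)) * (D * m ^ (-(1 / c)))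
        = P * (m ^ (-(1 / a)) * m ^ (-(1 / b) * κ) * m ^ (-(1 / c))) := by rw [hP]; ring
    rw [this, ← Real.rpow_add hm0, ← Real.rpow_add hm0]
    have : -(1 / a) + -(1 / b) * κ + -(1 / c) = -(1 / r) := by rw [hsum]; ring
    rw [this, Real.rpow_neg hm0.le, hm, ← Real.rpow_mul (by positivity),
      mul_one_div_cancel hr0.ne', Real.rpow_one, inv_div]
    field_simp
  have hsub : {x | s < F x * G x ^ κ * H x} ⊆ ({x | A * m ^ (-(1 / a)) < F x} ∪
      {x | B * m ^ (-(1 / b)) < G x}) ∪ {x | D * m ^ (-(1 / c)) < H x} := by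
    intro x hx
    by_contra h
    simp only [mem_union, mem_ofPred_eq, not_or, not_lt] at h
    obtain ⟨⟨hx1, hx2⟩, hx3⟩ := h
    have hx : s < F x * G x ^ κ * H x := hx
    refine absurd hx (not_lt.2 ?_)
    rw [← hprod]
    have := hG0 x
    have := hH0 x
    gcongr
  refine (measure_mono hsub).trans ((measure_union_le _ _).trans
    ((add_le_add ((measure_union_le _ _).trans (add_le_add h1 h2)) h3).trans ?_))
  rw [← ENNReal.ofReal_add hm0.le hm0.le, ← ENNReal.ofReal_add (by positivity) hm0.le]
  refine ENNReal.ofReal_le_ofReal ?_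
  rw [mul_div_assoc, Real.mul_rpow (x := 3) (by norm_num) (by positivity)]
  have := Real.self_le_rpow_of_one_le (x := 3) (by norm_num) hr
  nlinarith

theorem lintegral_Ioi_ofReal_div_rpow {r : ℝ} (hr : 1 < r) {A T : ℝ} (hA : 0 < A) (hT : 0 < T) :
    ∫⁻ s in Ioi T, ENNReal.ofReal ((A / s) ^ r)
      = ENNReal.ofReal (A ^ r * T ^ (1 - r) / (r - 1)) := by
  have h1 : ∀ s ∈ Ioi T, (A / s) ^ r = A ^ r * s ^ (-r) := fun s hs => by
    have hs : 0 < s := hT.trans hs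
    rw [Real.div_rpow hA.le hs.le, Real.rpow_neg hs.le, div_eq_mul_inv]
  rw [setLIntegral_congr_fun measurableSet_Ioi
    (fun s hs => congrArg ENNReal.ofReal (h1 s hs)), ← ofReal_integral_eq_lintegral_ofReal]
  · rw [integral_const_mul, integral_Ioi_rpow_of_lt (by linarith) hT]
    congr 1
    rw [show -r + 1 = -(r - 1) by ring, show 1 - r = -(r - 1) by ring]
    rw [neg_div_neg_eq, mul_div_assoc]
  · exact (integrableOn_Ioi_rpow_of_lt (by linarith) hT).const_mul _
  · refine (ae_restrict_mem measurableSet_Ioi).mono fun s hs => ?_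
    have hs : 0 < s := hT.trans hs
    simp only [Pi.zero_apply]; positivity

/-- The pairing of weak `L^r` with `L¹ ∩ L^∞`. -/
theorem IsWeakLp.lintegral_mul_le (hr : 1 < r) (hA : 0 < A) (hF : IsWeakLp μ r A F)
    (hFm : AEMeasurable F μ) {h : X → ENNReal} (hhm : AEMeasurable h μ) {H L : ℝ} (hH : 0 < H)
    (hL : 0 < L) (hhH : ∀ x, h x ≤ ENNReal.ofReal H) (hhL : ∫⁻ x, h x ∂μ ≤ ENNReal.ofReal L) :
    ∫⁻ x, h x * ENNReal.ofReal (F x) ∂μ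
      ≤ ENNReal.ofReal (r / (r - 1) * A * H ^ (1 / r) * L ^ (1 - 1 / r)) := by
  have hr0 : 0 < r := by linarith
  -- `F` is cut at the height which balances the two resulting bounds.
  set T := A * (H / L) ^ (1 / r) with hT
  have hT0 : 0 < T := by positivity
  have hexc : ∫⁻ x, ENNReal.ofReal (F x - T) ∂μ
      ≤ ENNReal.ofReal (A ^ r * T ^ (1 - r) / (r - 1)) := by
    have hm : AEMeasurable (fun x => Max.max 0 (F x - T)) μ := by fun_prop
    have h1 := lintegral_eq_lintegral_meas_lt μ
      (Eventually.of_forall fun x => le_max_left 0 (F x - T)) hm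
    have h2 : ∀ x, ENNReal.ofReal (F x - T) = ENNReal.ofReal (Max.max 0 (F x - T)) := fun x => by
      rcases le_total 0 (F x - T) with h | h
      · rw [max_eq_right h]
      · rw [max_eq_left h, ENNReal.ofReal_of_nonpos h, ENNReal.ofReal_zero]
    simp_rw [h2]
    rw [h1]
    calc ∫⁻ s in Ioi (0 : ℝ), μ {x | s < Max.max 0 (F x - T)}
        ≤ ∫⁻ s in Ioi (0 : ℝ), ENNReal.ofReal ((A / (s + T)) ^ r) := by
          refine setLIntegral_mono' measurableSet_Ioi fun s hs => ?_
          have hs : 0 < s := hs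
          refine (measure_mono fun x hx => ?_).trans (hF (s + T) (by positivity))
          have hx : s < Max.max 0 (F x - T) := hx
          rcases lt_max_iff.1 hx with h | h
          · linarith
          · simp only [mem_ofPred_eq]; linarith
      _ = ∫⁻ s in Ioi T, ENNReal.ofReal ((A / s) ^ r) := by
          have := (measurePreserving_add_right (volume : Measure ℝ) T).setLIntegral_comp_preimage_emb
            (measurableEmbedding_addRight T) (fun s => ENNReal.ofReal ((A / s) ^ r)) (Ioi T)
          rw [← this]
          congr 2
          ext s; simp
      _ = _ := lintegral_Ioi_ofReal_div_rpow hr hA hT0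
  calc ∫⁻ x, h x * ENNReal.ofReal (F x) ∂μ
      ≤ ∫⁻ x, (ENNReal.ofReal T * h x + ENNReal.ofReal H * ENNReal.ofReal (F x - T)) ∂μ := by
        refine lintegral_mono fun x => ?_
        calc h x * ENNReal.ofReal (F x) ≤ h x * (ENNReal.ofReal T + ENNReal.ofReal (F x - T)) := by
              gcongr
              refine le_trans (le_of_eq ?_) ENNReal.ofReal_add_le
              congr 1; ring
          _ ≤ _ := by
              rw [mul_add, mul_comm (h x) (ENNReal.ofReal T)]
              gcongr
              exact hhH x
    _ = ENNReal.ofReal T * ∫⁻ x, h x ∂μ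
          + ENNReal.ofReal H * ∫⁻ x, ENNReal.ofReal (F x - T) ∂μ := by
        rw [lintegral_add_left' (hhm.const_mul _), lintegral_const_mul' _ _ (by simp),
          lintegral_const_mul' _ _ (by simp)]
    _ ≤ ENNReal.ofReal T * ENNReal.ofReal L
          + ENNReal.ofReal H * ENNReal.ofReal (A ^ r * T ^ (1 - r) / (r - 1)) := by gcongr
    _ = ENNReal.ofReal (r / (r - 1) * A * H ^ (1 / r) * L ^ (1 - 1 / r)) := by
        have hr1 : 0 < r - 1 := by linarith
        rw [← ENNReal.ofReal_mul hT0.le, ← ENNReal.ofReal_mul hH.le,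
          ← ENNReal.ofReal_add (by positivity) (by positivity)]
        congr 1
        have e1 : T * L = A * H ^ (1 / r) * L ^ (1 - 1 / r) := by
          rw [hT, Real.div_rpow hH.le hL.le, Real.rpow_sub hL, Real.rpow_one]
          field_simp
        have e2 : H * (A ^ r * T ^ (1 - r)) = A * H ^ (1 / r) * L ^ (1 - 1 / r) := by
          rw [Real.rpow_sub hT0, Real.rpow_one]
          have e3 : T ^ r = A ^ r * (H / L) := by
            rw [hT, Real.mul_rpow hA.le (by positivity), ← Real.rpow_mul (by positivity),
              one_div_mul_cancel hr0.ne', Real.rpow_one]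
          rw [e3, ← e1]
          field_simp
        rw [mul_div_assoc', e2, e1]
        field_simp
        ring

/-- A bound for the averages over sets of finite measure gives a weak `L^r` bound. -/
theorem isWeakLp_of_setLIntegral_le {f : X → ℝ} (hr : 0 < r) (hA : 0 ≤ A) (hf : AEMeasurable f μ)
    (hfin : ∀ s, 0 < s → μ {x | s < |f x|} ≠ ⊤)
    (h : ∀ (S : Set X) (m : ℝ), 0 < m → μ S = ENNReal.ofReal m →
      ∫⁻ x in S, ‖f x‖ₑ ∂μ ≤ ENNReal.ofReal (A * m ^ (1 - 1 / r))) :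
    IsWeakLp μ r A (fun x => |f x|) := by
  intro s hs
  set S := {x | s < |f x|} with hS
  have hSm : NullMeasurableSet S μ := nullMeasurableSet_lt aemeasurable_const hf.abs
  set m := (μ S).toReal with hm
  have hmS : μ S = ENNReal.ofReal m := (ENNReal.ofReal_toReal (hfin s hs)).symm
  rcases (ENNReal.toReal_nonneg : 0 ≤ (μ S).toReal).eq_or_lt with h0 | h0
  · rw [hmS, hm, ← h0]; simp
  have h1 := h S m h0 hmS
  have h2 : ENNReal.ofReal (s * m) ≤ ENNReal.ofReal (A * m ^ (1 - 1 / r)) := by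
    refine le_trans ?_ h1
    rw [ENNReal.ofReal_mul hs.le, ← hmS, ← setLIntegral_const]
    refine lintegral_mono_ae ?_
    refine (ae_restrict_mem₀ hSm).mono fun x hx => ?_
    rw [← ofReal_norm, Real.norm_eq_abs]
    exact ENNReal.ofReal_le_ofReal (le_of_lt hx)
  have h3 := (ENNReal.ofReal_le_ofReal_iff (by positivity)).1 h2
  rw [hmS]
  refine ENNReal.ofReal_le_ofReal ?_
  rw [Real.rpow_sub h0, Real.rpow_one] at h3
  have h4 : m ^ (1 / r) ≤ A / s := by
    rw [le_div_iff₀ hs]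
    have : 0 < m ^ (1 / r) := by positivity
    rw [mul_div_assoc', le_div_iff₀ this] at h3
    have h5 : (m ^ (1 / r) * s) * m ≤ A * m := by linarith
    exact le_of_mul_le_mul_right h5 h0
  calc m = (m ^ (1 / r)) ^ r := by
        rw [← Real.rpow_mul h0.le, one_div_mul_cancel hr.ne', Real.rpow_one]
    _ ≤ (A / s) ^ r := by gcongr

end WeakLp

theorem exists_isWeakLp_norm_rpow {N : ℕ} (hN : 0 < N) {α : ℝ} (hα : α < 0) :
    ∃ A : ℝ, 0 < A ∧ IsWeakLp volume (N / -α) A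
      (fun y : EuclideanSpace ℝ (Fin N) => ‖y‖ ^ α) := by
  set ω := (volume (Metric.ball (0 : EuclideanSpace ℝ (Fin N)) 1)).toReal with hω
  have hωt : volume (Metric.ball (0 : EuclideanSpace ℝ (Fin N)) 1) ≠ ⊤ := measure_ball_lt_top.ne
  have hω0 : 0 < ω := ENNReal.toReal_pos (Metric.measure_ball_pos _ _ one_pos).ne' hωt
  have hN0 : (0 : ℝ) < N := by exact_mod_cast hN
  refine ⟨ω ^ (-α / N), by positivity, fun s hs => ?_⟩
  have hsub : {y : EuclideanSpace ℝ (Fin N) | s < ‖y‖ ^ α} ⊆ Metric.ball 0 (s ^ (1 / α)) := by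
    intro y hy
    have hy : s < ‖y‖ ^ α := hy
    rw [mem_ball_zero_iff]
    rcases (norm_nonneg y).eq_or_lt with h0 | h0
    · rw [← h0]; positivity
    · have := Real.rpow_lt_rpow_of_neg hs hy (z := 1 / α) (by rw [one_div]; exact inv_lt_zero.2 hα)
      rwa [← Real.rpow_mul h0.le, mul_one_div_cancel hα.ne, Real.rpow_one] at this
  refine (measure_mono hsub).trans (le_of_eq ?_)
  rw [Measure.addHaar_ball_of_pos _ _ (by positivity), finrank_euclideanSpace_fin,
    ← ENNReal.ofReal_toReal hωt, ← ENNReal.ofReal_mul (by positivity), ← hω]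
  congr 1
  rw [Real.div_rpow (by positivity) hs.le, ← Real.rpow_mul hω0.le, ← Real.rpow_natCast,
    ← Real.rpow_mul hs.le]
  have e1 : -α / N * (N / -α) = 1 := by have := hα.ne; field_simp
  have e2 : 1 / α * (N : ℝ) = -(N / -α) := by have := hα.ne; field_simp
  rw [e1, e2, Real.rpow_one, Real.rpow_neg hs.le, mul_comm, ← div_eq_mul_inv]

/-! ### Time integrals -/

theorem setLIntegral_preimage_sub_left (t : ℝ) (f : ℝ → ENNReal) (S : Set ℝ) :
    ∫⁻ s in (fun s => t - s) ⁻¹' S, f (t - s) = ∫⁻ s in S, f s :=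
  (Measure.measurePreserving_sub_left (volume : Measure ℝ) t).setLIntegral_comp_preimage_emb
    (MeasurableEquiv.subLeft t).measurableEmbedding f S

theorem setLIntegral_Ioo_sub_le (t : ℝ) (f : ℝ → ENNReal) :
    ∫⁻ s in Ioo 0 t, f (t - s) ≤ ∫⁻ s in Ioi 0, f s := by
  rw [← setLIntegral_preimage_sub_left t f]
  exact lintegral_mono_set fun s hs => sub_pos.2 hs.2

/-- The scale-invariant time integral: the exponent of decay exceeds `1`, so that the short and the
long times, separated at `m ^ (1 / a)`, contribute alike. -/
theorem lintegral_min_one_rpow_le {a b m : ℝ} (ha : 0 < a) (hb : 0 < b) (hab : 1 < a * b)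
    (hm : 0 < m) (t : ℝ) :
    ∫⁻ s in Ioo 0 t, ENNReal.ofReal (min 1 ((t - s) ^ (-a) * m) ^ b)
      ≤ ENNReal.ofReal ((1 + 1 / (a * b - 1)) * m ^ (1 / a)) := by
  refine (setLIntegral_Ioo_sub_le t
    (fun s => ENNReal.ofReal (min 1 (s ^ (-a) * m) ^ b))).trans ?_
  set T := m ^ (1 / a) with hT
  have hT0 : 0 < T := by positivity
  have hab' : 0 < a * b - 1 := by linarith
  rw [← Ioc_union_Ioi_eq_Ioi hT0.le]
  refine (lintegral_union_le _ _ _).trans ?_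
  have hnn : ∀ s : ℝ, 0 < s → 0 ≤ min 1 (s ^ (-a) * m) := fun s hs => by positivity
  have h1 : ∫⁻ s in Ioc 0 T, ENNReal.ofReal (min 1 (s ^ (-a) * m) ^ b) ≤ ENNReal.ofReal T := by
    calc _ ≤ ∫⁻ s in Ioc 0 T, 1 := by
          refine setLIntegral_mono' measurableSet_Ioc fun s hs => ?_
          rw [← ENNReal.ofReal_one]
          exact ENNReal.ofReal_le_ofReal
            (Real.rpow_le_one (hnn s hs.1) (min_le_left _ _) hb.le)
      _ = _ := by simp
  have h2 : ∫⁻ s in Ioi T, ENNReal.ofReal (min 1 (s ^ (-a) * m) ^ b)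
      ≤ ENNReal.ofReal (T / (a * b - 1)) := by
    calc _ ≤ ∫⁻ s in Ioi T, ENNReal.ofReal ((T / s) ^ (a * b)) := by
          refine setLIntegral_mono' measurableSet_Ioi fun s hs => ?_
          have hs : 0 < s := hT0.trans hs
          refine ENNReal.ofReal_le_ofReal ?_
          have : (T / s) ^ (a * b) = (s ^ (-a) * m) ^ b := by
            rw [Real.rpow_mul (by positivity), Real.div_rpow hT0.le hs.le, hT,
              ← Real.rpow_mul hm.le, one_div_mul_cancel ha.ne', Real.rpow_one,
              Real.rpow_neg hs.le, div_eq_mul_inv, mul_comm]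
          rw [this]
          exact Real.rpow_le_rpow (hnn s hs) (min_le_right _ _) hb.le
      _ = ENNReal.ofReal (T ^ (a * b) * T ^ (1 - a * b) / (a * b - 1)) :=
          lintegral_Ioi_ofReal_div_rpow hab hT0 hT0
      _ = _ := by
          rw [← Real.rpow_add hT0]; simp
  refine (add_le_add h1 h2).trans (le_of_eq ?_)
  rw [← ENNReal.ofReal_add hT0.le (by positivity)]
  congr 1; ring

theorem lintegral_Ioc_rpow {a t : ℝ} (ha : -1 < a) (ht : 0 < t) :
    ∫⁻ s in Ioc 0 t, ENNReal.ofReal (s ^ a) = ENNReal.ofReal (t ^ (a + 1) / (a + 1)) := by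
  rw [← ofReal_integral_eq_lintegral_ofReal, ← intervalIntegral.integral_of_le ht.le,
    integral_rpow (Or.inl ha), Real.zero_rpow (by linarith), sub_zero]
  · exact (intervalIntegrable_iff_integrableOn_Ioc_of_le ht.le).1
      (intervalIntegral.intervalIntegrable_rpow' ha)
  · refine (ae_restrict_mem measurableSet_Ioc).mono fun s hs => ?_
    exact Real.rpow_nonneg hs.1.le _

/-- The Beta integral is independent of `t` since the two exponents add up to `-1`. -/
theorem lintegral_rpow_mul_rpow_le {σ : ℝ} (h1 : -1 < σ) (h0 : σ < 0) {t : ℝ} (ht : 0 < t) :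
    ∫⁻ s in Ioo 0 t, ENNReal.ofReal (s ^ σ * (t - s) ^ (-(σ + 1)))
      ≤ ENNReal.ofReal (1 / (σ + 1) + 1 / -σ) := by
  have hs1 : 0 < σ + 1 := by linarith
  have hs0 : 0 < -σ := by linarith
  have ht2 : 0 < t / 2 := by positivity
  have hsub : Ioo 0 t ⊆ Ioc 0 (t / 2) ∪ Ioo (t / 2) t := fun s hs => by
    rcases le_or_gt s (t / 2) with h | h
    · exact Or.inl ⟨hs.1, h⟩
    · exact Or.inr ⟨h, hs.2⟩
  refine (lintegral_mono_set hsub).trans ((lintegral_union_le _ _ _).trans ?_)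
  have e1 : ∫⁻ s in Ioc 0 (t / 2), ENNReal.ofReal (s ^ σ * (t - s) ^ (-(σ + 1)))
      ≤ ENNReal.ofReal (1 / (σ + 1)) := by
    calc _ ≤ ∫⁻ s in Ioc 0 (t / 2),
          ENNReal.ofReal ((t / 2) ^ (-(σ + 1))) * ENNReal.ofReal (s ^ σ) := by
          refine setLIntegral_mono' measurableSet_Ioc fun s hs => ?_
          rw [← ENNReal.ofReal_mul (by positivity), mul_comm (s ^ σ)]
          refine ENNReal.ofReal_le_ofReal ?_
          have := hs.1
          gcongr ?_ * _
          exact Real.rpow_le_rpow_of_nonpos ht2 (by linarith [hs.2]) (by linarith)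
      _ = ENNReal.ofReal (1 / (σ + 1)) := by
          rw [lintegral_const_mul' _ _ (by simp), lintegral_Ioc_rpow h1 ht2,
            ← ENNReal.ofReal_mul (by positivity), mul_div_assoc', ← Real.rpow_add ht2]
          simp
  have e2 : ∫⁻ s in Ioo (t / 2) t, ENNReal.ofReal (s ^ σ * (t - s) ^ (-(σ + 1)))
      ≤ ENNReal.ofReal (1 / -σ) := by
    calc _ ≤ ∫⁻ s in Ioo (t / 2) t,
          ENNReal.ofReal ((t / 2) ^ σ) * ENNReal.ofReal ((t - s) ^ (-(σ + 1))) := by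
          refine setLIntegral_mono' measurableSet_Ioo fun s hs => ?_
          rw [← ENNReal.ofReal_mul (by positivity)]
          refine ENNReal.ofReal_le_ofReal ?_
          have := sub_pos.2 hs.2
          gcongr ?_ * _
          exact Real.rpow_le_rpow_of_nonpos ht2 hs.1.le h0.le
      _ ≤ ENNReal.ofReal ((t / 2) ^ σ) *
            ∫⁻ s in Ioc 0 (t / 2), ENNReal.ofReal (s ^ (-(σ + 1))) := by
          rw [lintegral_const_mul' _ _ (by simp)]
          refine mul_le_mul_right ?_ _
          rw [← setLIntegral_preimage_sub_left t (fun s => ENNReal.ofReal (s ^ (-(σ + 1))))]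
          refine lintegral_mono_set fun s hs => ?_
          simp only [mem_preimage, mem_Ioc]
          constructor <;> linarith [hs.1, hs.2]
      _ = ENNReal.ofReal (1 / -σ) := by
          rw [lintegral_Ioc_rpow (by linarith) ht2,
            ← ENNReal.ofReal_mul (by positivity), mul_div_assoc', ← Real.rpow_add ht2]
          simp
  rw [ENNReal.ofReal_add (by positivity) (by positivity)]
  exact add_le_add e1 e2

/-! ### Weak estimates for the Duhamel integrals -/

section Duhamel

variable {N : ℕ} {d C : ℝ}

/-- The `L¹` and `L^∞` bounds on the kernel, with a common constant. -/
structure PolyheatBound (N : ℕ) (d C : ℝ) : Prop where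
  pos : 0 < C
  lintegral_le : ∀ t, 0 < t →
    ∫⁻ x : EuclideanSpace ℝ (Fin N), ‖polyheatKernel d t x‖ₑ ≤ ENNReal.ofReal C
  enorm_le : ∀ t, 0 < t → ∀ x : EuclideanSpace ℝ (Fin N),
    ‖polyheatKernel d t x‖ₑ ≤ ENNReal.ofReal (C * t ^ (-(N / (2 * d))))

theorem exists_polyheatBound (hN : 0 < N) (hd : 0 < d) : ∃ C, PolyheatBound N d C := by
  obtain ⟨C₁, h₁, h₁'⟩ := exists_lintegral_polyheatKernel_le hN hd
  obtain ⟨C₂, h₂, h₂'⟩ := exists_enorm_polyheatKernel_le (N := N) hd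
  refine ⟨max C₁ C₂, lt_max_of_lt_left h₁, fun t ht => (h₁' t ht).trans ?_,
    fun t ht x => (h₂' t ht x).trans ?_⟩
  · exact ENNReal.ofReal_le_ofReal (le_max_left _ _)
  · refine ENNReal.ofReal_le_ofReal ?_
    gcongr
    exact le_max_right _ _

/-- The action on the indicator of a set of measure `m` of the semigroup with kernel
`|E_d(·, τ)|`, paired with a function in weak `L^r`. -/
theorem PolyheatBound.lintegral_mul_le (hC : PolyheatBound N d C) {r A : ℝ} (hr : 1 < r)
    (hA : 0 < A) {F : EuclideanSpace ℝ (Fin N) → ℝ} (hF : IsWeakLp volume r A F)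
    (hFm : AEMeasurable F) {S : Set (EuclideanSpace ℝ (Fin N))} {m : ℝ} (hm : 0 < m)
    (hS : volume S = ENNReal.ofReal m) {τ : ℝ} (hτ : 0 < τ) :
    ∫⁻ y, (∫⁻ x in S, ‖polyheatKernel d τ (x - y)‖ₑ) * ENNReal.ofReal (F y)
      ≤ ENNReal.ofReal (r / (r - 1) * C * A * m ^ (1 - 1 / r)
        * min 1 (τ ^ (-(N / (2 * d))) * m) ^ (1 / r)) := by
  have hC0 := hC.pos
  have hK : Measurable fun z : EuclideanSpace ℝ (Fin N) × EuclideanSpace ℝ (Fin N) =>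
      ‖polyheatKernel d τ (z.1 - z.2)‖ₑ :=
    ((measurable_polyheatKernel d).comp (by fun_prop : Measurable fun z :
      EuclideanSpace ℝ (Fin N) × EuclideanSpace ℝ (Fin N) => (τ, z.1 - z.2))).enorm
  have hKτ : Measurable fun z : EuclideanSpace ℝ (Fin N) => ‖polyheatKernel d τ z‖ₑ :=
    ((measurable_polyheatKernel d).comp (by fun_prop : Measurable fun z :
      EuclideanSpace ℝ (Fin N) => (τ, z))).enorm
  set h : EuclideanSpace ℝ (Fin N) → ENNReal :=
    fun y => ∫⁻ x in S, ‖polyheatKernel d τ (x - y)‖ₑ with hh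
  have hhm : Measurable h := Measurable.lintegral_prod_left hK
  have hM : 0 < min 1 (τ ^ (-(N / (2 * d))) * m) := by positivity
  have hH : ∀ y, h y ≤ ENNReal.ofReal (C * min 1 (τ ^ (-(N / (2 * d))) * m)) := by
    intro y
    rw [mul_min_of_nonneg _ _ hC0.le, ENNReal.ofReal_min]
    refine le_min ?_ ?_
    · rw [mul_one]
      calc h y ≤ ∫⁻ x, ‖polyheatKernel d τ (x - y)‖ₑ := setLIntegral_le_lintegral _ _
        _ = ∫⁻ x : EuclideanSpace ℝ (Fin N), ‖polyheatKernel d τ x‖ₑ :=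
          lintegral_sub_right_eq_self (fun x => ‖polyheatKernel d τ x‖ₑ) y
        _ ≤ _ := hC.lintegral_le τ hτ
    · calc h y ≤ ∫⁻ x in S, ENNReal.ofReal (C * τ ^ (-(N / (2 * d)))) :=
          lintegral_mono fun x => hC.enorm_le τ hτ _
        _ = _ := by
          rw [setLIntegral_const, hS, ← ENNReal.ofReal_mul (by positivity), mul_assoc]
  have hL : ∫⁻ y, h y ≤ ENNReal.ofReal (C * m) := by
    rw [hh, lintegral_lintegral_swap (by exact (hK.comp measurable_swap).aemeasurable)]
    calc _ ≤ ∫⁻ x in S, ENNReal.ofReal C := by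
          refine lintegral_mono fun x => ?_
          refine le_trans (le_of_eq ?_) (hC.lintegral_le τ hτ)
          exact lintegral_sub_left_eq_self (fun x => ‖polyheatKernel d τ x‖ₑ) x
      _ = _ := by rw [setLIntegral_const, hS, ← ENNReal.ofReal_mul hC0.le]
  refine (hF.lintegral_mul_le hr hA hFm hhm.aemeasurable (by positivity) (by positivity) hH
    hL).trans (le_of_eq ?_)
  congr 1
  have : C ^ (1 / r) * C ^ (1 - 1 / r) = C := by
    rw [← Real.rpow_add hC0]; simp
  rw [Real.mul_rpow hC0.le hM.le, Real.mul_rpow hC0.le hm.le]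
  calc _ = r / (r - 1) * (C ^ (1 / r) * C ^ (1 - 1 / r)) * A * m ^ (1 - 1 / r)
        * min 1 (τ ^ (-(N / (2 * d))) * m) ^ (1 / r) := by ring
    _ = _ := by rw [this]

/-- The semigroup with kernel `|E_d(·, τ)|` is bounded on weak `L^r`, uniformly in `τ`. -/
theorem PolyheatBound.setLIntegral_polyheat_le (hC : PolyheatBound N d C) {r A : ℝ} (hr : 1 < r)
    (hA : 0 < A) {F : EuclideanSpace ℝ (Fin N) → ℝ} (hF : IsWeakLp volume r A F)
    (hFm : AEMeasurable F) {S : Set (EuclideanSpace ℝ (Fin N))} {m : ℝ} (hm : 0 < m)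
    (hS : volume S = ENNReal.ofReal m) {τ : ℝ} (hτ : 0 < τ) :
    ∫⁻ x in S, ∫⁻ y, ‖polyheatKernel d τ (x - y)‖ₑ * ENNReal.ofReal (F y)
      ≤ ENNReal.ofReal (r / (r - 1) * C * A * m ^ (1 - 1 / r)) := by
  have hK : Measurable fun z : EuclideanSpace ℝ (Fin N) × EuclideanSpace ℝ (Fin N) =>
      ‖polyheatKernel d τ (z.1 - z.2)‖ₑ :=
    ((measurable_polyheatKernel d).comp (by fun_prop : Measurable fun z :
      EuclideanSpace ℝ (Fin N) × EuclideanSpace ℝ (Fin N) => (τ, z.1 - z.2))).enorm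
  rw [lintegral_lintegral_swap (by exact hK.aemeasurable.mul hFm.ennreal_ofReal.comp_snd)]
  have : ∀ y, ∫⁻ x in S, ‖polyheatKernel d τ (x - y)‖ₑ * ENNReal.ofReal (F y)
      = (∫⁻ x in S, ‖polyheatKernel d τ (x - y)‖ₑ) * ENNReal.ofReal (F y) := fun y =>
    lintegral_mul_const' _ _ (by simp)
  simp_rw [this]
  refine (hC.lintegral_mul_le hr hA hF hFm hm hS hτ).trans (ENNReal.ofReal_le_ofReal ?_)
  have hC0 := hC.pos
  have : 0 < r - 1 := by linarith
  refine mul_le_of_le_one_right (by positivity) ?_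
  exact Real.rpow_le_one (by positivity) (min_le_left _ _) (by positivity)

/-- The averages over a set of measure `m` of a Duhamel integral with a source in weak `L^r`,
reduced to a scalar integral in time. -/
theorem PolyheatBound.setLIntegral_duhamel_le (hC : PolyheatBound N d C) {r : ℝ} (hr : 1 < r)
    {t : ℝ} {F : ℝ × EuclideanSpace ℝ (Fin N) → ℝ}
    (hFm : AEMeasurable F ((volume.restrict (Ioo 0 t)).prod volume)) {A : ℝ → ℝ}
    (hA : ∀ s ∈ Ioo 0 t, 0 < A s ∧ IsWeakLp volume r (A s) (fun y => F (s, y)))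
    {S : Set (EuclideanSpace ℝ (Fin N))} {m : ℝ} (hm : 0 < m) (hS : volume S = ENNReal.ofReal m) :
    ∫⁻ x in S, ∫⁻ z, ‖polyheatKernel d (t - z.1) (x - z.2)‖ₑ * ENNReal.ofReal (F z)
        ∂((volume.restrict (Ioo 0 t)).prod volume)
      ≤ ENNReal.ofReal (r / (r - 1) * C * m ^ (1 - 1 / r)) *
        ∫⁻ s in Ioo 0 t, ENNReal.ofReal
          (A s * min 1 ((t - s) ^ (-(N / (2 * d))) * m) ^ (1 / r)) := by
  have hC0 := hC.pos
  have hr1 : 0 < r - 1 := by linarith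
  have hK : Measurable fun z : EuclideanSpace ℝ (Fin N) × (ℝ × EuclideanSpace ℝ (Fin N)) =>
      ‖polyheatKernel d (t - z.2.1) (z.1 - z.2.2)‖ₑ :=
    ((measurable_polyheatKernel d).comp (by fun_prop : Measurable fun z :
      EuclideanSpace ℝ (Fin N) × (ℝ × EuclideanSpace ℝ (Fin N)) =>
        (t - z.2.1, z.1 - z.2.2))).enorm
  rw [lintegral_lintegral_swap (by exact hK.aemeasurable.mul hFm.ennreal_ofReal.comp_snd)]
  have : ∀ z : ℝ × EuclideanSpace ℝ (Fin N),
      ∫⁻ x in S, ‖polyheatKernel d (t - z.1) (x - z.2)‖ₑ * ENNReal.ofReal (F z)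
      = (∫⁻ x in S, ‖polyheatKernel d (t - z.1) (x - z.2)‖ₑ) * ENNReal.ofReal (F z) := fun z =>
    lintegral_mul_const' _ _ (by simp)
  simp_rw [this]
  rw [lintegral_prod _ (by
    exact (Measurable.lintegral_prod_left' hK).aemeasurable.mul hFm.ennreal_ofReal),
    ← lintegral_const_mul' _ _ (by simp)]
  have hsec : ∀ᵐ s ∂(volume.restrict (Ioo 0 t)), AEMeasurable fun y => F (s, y) :=
    hFm.aestronglyMeasurable.prodMk_left.mono fun s hs => hs.aemeasurable
  refine lintegral_mono_ae ?_
  filter_upwards [hsec, ae_restrict_mem measurableSet_Ioo] with s hs1 hs2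
  refine (hC.lintegral_mul_le hr (hA s hs2).1 (hA s hs2).2 hs1 hm hS
    (sub_pos.2 hs2.2)).trans (le_of_eq ?_)
  rw [← ENNReal.ofReal_mul (by positivity)]
  congr 1
  ring

end Duhamel

/-! ### The critical exponents -/

/-- The relations between the exponents: `q = p_c` is the critical exponent, `l` is the exponent of
the forcing term, and the nonlinearity of a curve with values in weak `L^q` takes its values in
weak `L^r`. -/
structure CriticalExponents (N : ℕ) (d α p σ q r l : ℝ) : Prop where
  dim_pos : 0 < N
  d_pos : 0 < d
  α_neg : α < 0
  p_gt : 1 < p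
  σ_gt : -1 < σ
  σ_neg : σ < 0
  q_gt : 1 < q
  r_gt : 1 < r
  l_gt : 1 < l
  inv_r : 1 / r = 1 / q + 2 * d / N
  inv_r' : 1 / r = 1 / (N / -α) + (p - 1) / q + 1 / q
  inv_l : 1 / l = 1 / q + (σ + 1) * (2 * d / N)

/-- The lower bound on `p` says exactly that `r > 1`. -/
theorem criticalExponents {N : ℕ} {d α p σ q l : ℝ} (hd : 0 < d) (hα : 0 < -α ∧ -α < 2 * d)
    (hN : 2 * d < N) (hp : (N + α) / (N - 2 * d) < p) (hσ : -1 < σ ∧ σ < 0)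
    (hq : q = N * (p - 1) / (2 * d + α)) (hl : l = N * q / (N + 2 * (σ + 1) * d * q)) :
    CriticalExponents N d α p σ q (1 / (1 / q + 2 * d / N)) l := by
  obtain ⟨hα0, hα2⟩ := hα
  obtain ⟨hσ1, hσ0⟩ := hσ
  have hN0 : (0 : ℝ) < N := by linarith
  have hNd : (0 : ℝ) < N - 2 * d := by linarith
  have hda : 0 < 2 * d + α := by linarith
  rw [div_lt_iff₀ hNd] at hp
  have hp1 : 1 < p := by
    by_contra h
    nlinarith [mul_le_mul_of_nonneg_right (not_lt.1 h) hNd.le]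
  have hp0 : 0 < p - 1 := by linarith
  have hq0 : 0 < q := by rw [hq]; positivity
  have hqN : q * (2 * d + α) = N * (p - 1) := by rw [hq]; field_simp
  have hqlow : N < q * (N - 2 * d) := by
    rw [hq, div_mul_eq_mul_div, lt_div_iff₀ hda]
    have : 2 * d + α < (p - 1) * (N - 2 * d) := by linarith
    nlinarith
  have hsum : 1 / q + 2 * d / N < 1 := by
    rw [div_add_div _ _ hq0.ne' hN0.ne', div_lt_one (by positivity)]
    linarith
  have hsum0 : 0 < 1 / q + 2 * d / N := by positivity
  have hinvl : 1 / l = 1 / q + (σ + 1) * (2 * d / N) := by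
    rw [hl]
    have : 0 < N + 2 * (σ + 1) * d * q := by
      have : 0 < σ + 1 := by linarith
      positivity
    field_simp
  have hσd : 0 < (σ + 1) * (2 * d / N) := by
    have : 0 < σ + 1 := by linarith
    positivity
  have hl1 : 1 / l < 1 := by
    rw [hinvl]
    have : 0 < 2 * d / N := by positivity
    nlinarith
  have hl0 : 0 < 1 / l := by rw [hinvl]; positivity
  have hlpos : 0 < l := one_div_pos.1 hl0
  refine ⟨by exact_mod_cast hN0, hd, by linarith, hp1, hσ1, hσ0, ?_, ?_, ?_, ?_, ?_, hinvl⟩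
  · nlinarith
  · rw [lt_div_iff₀ hsum0, one_mul]; exact hsum
  · rwa [div_lt_one hlpos] at hl1
  · rw [one_div_one_div]
  · rw [one_div_one_div, one_div_div]
    field_simp
    linarith

section Estimates

variable {N : ℕ} {d α p σ q r l : ℝ}

/-- The Duhamel integral of `|y|^α a^(p-1) b` is bounded in weak `L^q` at each time by the
sizes of `a` and `b` in weak `L^q`, with a constant that does not depend on the time. -/
theorem CriticalExponents.exists_nonlinear_le (h : CriticalExponents N d α p σ q r l) {C : ℝ}
    (hC : PolyheatBound N d C) :
    ∃ K : ℝ, 0 < K ∧ ∀ (t M D : ℝ) (a b : ℝ × EuclideanSpace ℝ (Fin N) → ℝ), 0 < M → 0 < D →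
      (∀ z, 0 ≤ a z) → (∀ z, 0 ≤ b z) →
      AEMeasurable a ((volume.restrict (Ioo 0 t)).prod volume) →
      AEMeasurable b ((volume.restrict (Ioo 0 t)).prod volume) →
      (∀ s ∈ Ioo 0 t, IsWeakLp volume q M fun y => a (s, y)) →
      (∀ s ∈ Ioo 0 t, IsWeakLp volume q D fun y => b (s, y)) →
      ∀ (S : Set (EuclideanSpace ℝ (Fin N))) (m : ℝ), 0 < m → volume S = ENNReal.ofReal m →
      ∫⁻ x in S, ∫⁻ z, ‖polyheatKernel d (t - z.1) (x - z.2)‖ₑ *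
          ENNReal.ofReal (‖z.2‖ ^ α * a z ^ (p - 1) * b z)
          ∂((volume.restrict (Ioo 0 t)).prod volume)
        ≤ ENNReal.ofReal (K * M ^ (p - 1) * D * m ^ (1 - 1 / q)) := by
  obtain ⟨A₀, hA₀, hweight⟩ := exists_isWeakLp_norm_rpow h.dim_pos h.α_neg
  have hC0 := hC.pos
  have hN0 : (0 : ℝ) < N := by exact_mod_cast h.dim_pos
  have hr1 : 0 < r - 1 := sub_pos.2 h.r_gt
  have hr0 : 0 < r := by linarith
  have hq0 : 0 < q := one_pos.trans h.q_gt
  have hd0 := h.d_pos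
  have hα0 := neg_pos.2 h.α_neg
  -- Integrability in time at infinity, from `1 / r > 2 d / N`.
  have hexp : 1 < N / (2 * d) * (1 / r) := by
    rw [h.inv_r, mul_add, div_mul_div_cancel₀ (by positivity), div_self hN0.ne']
    have : 0 < N / (2 * d) * (1 / q) := by positivity
    linarith
  have hexp' : 0 < N / (2 * d) * (1 / r) - 1 := by linarith
  refine ⟨r / (r - 1) * C * (3 * A₀) * (1 + 1 / (N / (2 * d) * (1 / r) - 1)), by positivity, ?_⟩
  intro t M D a b hM hD ha0 hb0 ham hbm ha hb S m hm hS
  have hprod : ∀ s ∈ Ioo 0 t, 0 < 3 * (A₀ * M ^ (p - 1) * D) ∧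
      IsWeakLp volume r (3 * (A₀ * M ^ (p - 1) * D))
        (fun y : EuclideanSpace ℝ (Fin N) => ‖y‖ ^ α * a (s, y) ^ (p - 1) * b (s, y)) :=
    fun s hs => ⟨by positivity, IsWeakLp.mul₃ (by positivity) hq0 hq0 (sub_pos.2 h.p_gt) h.r_gt.le
      h.inv_r' hA₀ hM hD (fun _ => ha0 _) (fun _ => hb0 _) hweight (ha s hs) (hb s hs)⟩
  have hm1 : AEMeasurable (fun z : ℝ × EuclideanSpace ℝ (Fin N) =>
      ‖z.2‖ ^ α * a z ^ (p - 1) * b z) ((volume.restrict (Ioo 0 t)).prod volume) := by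
    have : Measurable fun z : ℝ × EuclideanSpace ℝ (Fin N) => ‖z.2‖ ^ α := by fun_prop
    exact (this.aemeasurable.mul (ham.pow_const _)).mul hbm
  refine (hC.setLIntegral_duhamel_le h.r_gt hm1 (A := fun _ => 3 * (A₀ * M ^ (p - 1) * D))
    hprod hm hS).trans ?_
  simp_rw [ENNReal.ofReal_mul (show 0 ≤ 3 * (A₀ * M ^ (p - 1) * D) by positivity)]
  rw [lintegral_const_mul' _ _ ENNReal.ofReal_ne_top]
  refine (mul_le_mul_right (mul_le_mul_right
    (lintegral_min_one_rpow_le (by positivity) (by positivity) hexp hm t) _) _).trans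
    (le_of_eq ?_)
  rw [← ENNReal.ofReal_mul (by positivity), ← ENNReal.ofReal_mul (by positivity)]
  congr 1
  have : m ^ (1 - 1 / q) = m ^ (1 - 1 / r) * m ^ (1 / (N / (2 * d))) := by
    rw [← Real.rpow_add hm, h.inv_r, one_div_div]
    congr 1; ring
  rw [this]
  ring

/-- The forcing term is bounded in weak `L^q`, uniformly in time, by its profile in weak `L^l`. -/
theorem CriticalExponents.exists_forcing_le (h : CriticalExponents N d α p σ q r l) {C : ℝ}
    (hC : PolyheatBound N d C) :
    ∃ K : ℝ, 0 < K ∧ ∀ (t D : ℝ) (w : EuclideanSpace ℝ (Fin N) → ℝ), 0 < t → 0 < D →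
      AEMeasurable w → IsWeakLp volume l D (fun y => |w y|) →
      ∀ (S : Set (EuclideanSpace ℝ (Fin N))) (m : ℝ), 0 < m → volume S = ENNReal.ofReal m →
      ∫⁻ x in S, ∫⁻ z, ‖polyheatKernel d (t - z.1) (x - z.2)‖ₑ *
          ENNReal.ofReal (z.1 ^ σ * |w z.2|) ∂((volume.restrict (Ioo 0 t)).prod volume)
        ≤ ENNReal.ofReal (K * D * m ^ (1 - 1 / q)) := by
  have hC0 := hC.pos
  have hN0 : (0 : ℝ) < N := by exact_mod_cast h.dim_pos
  have hl1 : 0 < l - 1 := sub_pos.2 h.l_gt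
  have hl0 : 0 < l := by linarith
  have hq0 : 0 < q := one_pos.trans h.q_gt
  have hd0 := h.d_pos
  have hσ1 : 0 < σ + 1 := by linarith [h.σ_gt]
  have hσ0 : 0 < -σ := by linarith [h.σ_neg]
  refine ⟨l / (l - 1) * C * (1 / (σ + 1) + 1 / -σ), by positivity, ?_⟩
  intro t D w ht hD hwm hw S m hm hS
  have hFm : AEMeasurable (fun z : ℝ × EuclideanSpace ℝ (Fin N) => z.1 ^ σ * |w z.2|)
      ((volume.restrict (Ioo 0 t)).prod volume) := by
    have : Measurable fun z : ℝ × EuclideanSpace ℝ (Fin N) => z.1 ^ σ := by fun_prop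
    exact this.aemeasurable.mul hwm.abs.comp_snd
  have hA : ∀ s ∈ Ioo 0 t, 0 < s ^ σ * D ∧ IsWeakLp volume l (s ^ σ * D)
      (fun y => s ^ σ * |w y|) := by
    intro s hs
    have hs0 : 0 < s ^ σ := Real.rpow_pos_of_pos hs.1 _
    refine ⟨by positivity, fun τ hτ => ?_⟩
    have := hw (τ / s ^ σ) (by positivity)
    rw [div_div_eq_mul_div, mul_comm D] at this
    refine le_trans (measure_mono fun y hy => ?_) this
    have hy : τ < s ^ σ * |w y| := hy
    show τ / s ^ σ < |w y|
    rwa [div_lt_iff₀' hs0]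
  refine (hC.setLIntegral_duhamel_le h.l_gt hFm (A := fun s => s ^ σ * D) hA hm hS).trans ?_
  -- Of the decay available in time, only the part of exponent `σ + 1` is used.
  set θ := (σ + 1) * (2 * d / N) with hθ
  have hθ0 : 0 < θ := by positivity
  have hθl : θ ≤ 1 / l := by rw [h.inv_l]; linarith [one_div_pos.2 hq0]
  have hpt : ∀ s ∈ Ioo 0 t, s ^ σ * D * min 1 ((t - s) ^ (-(N / (2 * d))) * m) ^ (1 / l)
      ≤ D * m ^ θ * (s ^ σ * (t - s) ^ (-(σ + 1))) := by
    intro s hs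
    have hs0 := hs.1
    have hts : 0 < t - s := sub_pos.2 hs.2
    have h1 : min 1 ((t - s) ^ (-(N / (2 * d))) * m) ^ (1 / l)
        ≤ ((t - s) ^ (-(N / (2 * d))) * m) ^ θ :=
      (Real.rpow_le_rpow_of_exponent_ge (by positivity) (min_le_left _ _) hθl).trans
        (Real.rpow_le_rpow (by positivity) (min_le_right _ _) hθ0.le)
    have h2 : ((t - s) ^ (-(N / (2 * d))) * m) ^ θ = (t - s) ^ (-(σ + 1)) * m ^ θ := by
      rw [Real.mul_rpow (by positivity) hm.le, ← Real.rpow_mul hts.le]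
      congr 2
      rw [hθ]; field_simp
    rw [h2] at h1
    calc _ ≤ s ^ σ * D * ((t - s) ^ (-(σ + 1)) * m ^ θ) := by gcongr
      _ = _ := by ring
  refine (mul_le_mul_right ((setLIntegral_mono' measurableSet_Ioo fun s hs =>
    ENNReal.ofReal_le_ofReal (hpt s hs)).trans (le_of_eq_of_le ?_ (mul_le_mul_right
      (lintegral_rpow_mul_rpow_le h.σ_gt h.σ_neg ht) (ENNReal.ofReal (D * m ^ θ))))) _).trans
    (le_of_eq ?_)
  · rw [← lintegral_const_mul' _ _ (by simp)]
    refine lintegral_congr fun s => ?_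
    rw [ENNReal.ofReal_mul (by positivity)]
  · rw [← ENNReal.ofReal_mul (by positivity), ← ENNReal.ofReal_mul (by positivity)]
    congr 1
    have : m ^ (1 - 1 / q) = m ^ (1 - 1 / l) * m ^ θ := by
      rw [← Real.rpow_add hm, h.inv_l]
      congr 1; ring
    rw [this]
    ring

theorem abs_rpow_sub_abs_rpow_le {p : ℝ} (hp : 1 ≤ p) (a b : ℝ) :
    |(|a| ^ p - |b| ^ p)| ≤ p * max |a| |b| ^ (p - 1) * |a - b| := by
  have hM : 0 ≤ max |a| |b| := le_max_of_le_left (abs_nonneg a)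
  have key := (convex_Icc (0 : ℝ) (max |a| |b|)).norm_image_sub_le_of_norm_hasDerivWithin_le
    (f := fun x => x ^ p) (f' := fun x => p * x ^ (p - 1)) (C := p * max |a| |b| ^ (p - 1))
    (fun x _ => (Real.hasDerivAt_rpow_const (Or.inr hp)).hasDerivWithinAt)
    (fun x hx => by
      rw [Real.norm_of_nonneg (by have := hx.1; positivity)]
      exact mul_le_mul_of_nonneg_left
        (Real.rpow_le_rpow hx.1 hx.2 (by linarith)) (by linarith))
    (x := |b|) (y := |a|) ⟨abs_nonneg _, le_max_right _ _⟩ ⟨abs_nonneg _, le_max_left _ _⟩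
  rw [Real.norm_eq_abs, Real.norm_eq_abs] at key
  exact key.trans (mul_le_mul_of_nonneg_left (abs_abs_sub_abs_le a b) (by positivity))

end Estimates

/-! ### A priori bound and contraction -/

section Solutions

variable {N : ℕ} {d α p σ q r l : ℝ}

theorem IsContinuousLpCurve.aemeasurable_Ioo {Q : ENNReal}
    {u : ℝ → EuclideanSpace ℝ (Fin N) → ℝ} (hu : IsContinuousLpCurve Q u) (t : ℝ) :
    AEMeasurable (fun z : ℝ × EuclideanSpace ℝ (Fin N) => u z.1 z.2)
      ((volume.restrict (Ioo 0 t)).prod volume) :=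
  hu.aestronglyMeasurable.aemeasurable.mono_measure
    (Measure.prod_mono (Measure.restrict_mono Ioo_subset_Ioi_self le_rfl) le_rfl)

theorem measure_lt_abs_ne_top {X : Type*} [MeasurableSpace X] {μ : Measure X} {f : X → ℝ}
    (hq : 0 < q) (hf : MemLp f (ENNReal.ofReal q) μ) {s : ℝ} (hs : 0 < s) :
    μ {x | s < |f x|} ≠ ⊤ :=
  ne_top_of_le_ne_top ENNReal.ofReal_ne_top <|
    isWeakLp_of_eLpNorm_le hq ENNReal.toReal_nonneg hf.1
      (le_of_eq (ENNReal.ofReal_toReal hf.2.ne).symm) s hs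

/-- A solution whose values at the times before `t` are bounded by `M` in weak `L^q` obeys at time
`t` a bound that is linear in the data and superlinear in `M`. -/
theorem CriticalExponents.exists_isWeakLp_le (h : CriticalExponents N d α p σ q r l) :
    ∃ K : ℝ, 0 < K ∧ ∀ (ε : ℝ) (u₀ w : EuclideanSpace ℝ (Fin N) → ℝ)
      (u : ℝ → EuclideanSpace ℝ (Fin N) → ℝ), 0 < ε →
      AEStronglyMeasurable u₀ volume → AEStronglyMeasurable w volume →
      IsWeakLp volume q ε (fun y => |u₀ y|) → IsWeakLp volume l ε (fun y => |w y|) →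
      IsContinuousLpCurve (ENNReal.ofReal q) u →
      IsDuhamelSolution d α p (fun s => s ^ σ) u₀ w u →
      ∀ t M : ℝ, 0 < t → 0 < M → (∀ s ∈ Ioo 0 t, IsWeakLp volume q M fun y => |u s y|) →
        IsWeakLp volume q (K * (ε + M ^ (p - 1) * M)) fun y => |u t y| := by
  obtain ⟨C, hC⟩ := exists_polyheatBound h.dim_pos h.d_pos
  obtain ⟨K₂, hK₂, hnl⟩ := h.exists_nonlinear_le hC
  obtain ⟨K₃, hK₃, hfo⟩ := h.exists_forcing_le hC
  have hC0 := hC.pos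
  have hq0 : 0 < q := one_pos.trans h.q_gt
  have hq1 : 0 < q - 1 := sub_pos.2 h.q_gt
  set K₁ := q / (q - 1) * C with hK₁
  have hK₁0 : 0 < K₁ := by positivity
  refine ⟨K₁ + K₂ + K₃, by positivity, ?_⟩
  intro ε u₀ w u hε hu₀m hwm hu₀ hw hu hsol t M ht hM hweak
  refine isWeakLp_of_setLIntegral_le hq0 (by positivity) (hu.memLp t ht.le).1.aemeasurable
    (fun s hs => measure_lt_abs_ne_top hq0 (hu.memLp t ht.le) hs) fun S m hm hS => ?_
  have e1 := hC.setLIntegral_polyheat_le h.q_gt hε hu₀ hu₀m.aemeasurable.abs hm hS ht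
  have hum := (hu.aemeasurable_Ioo t).abs
  have e2 := hnl t M M (fun z => |u z.1 z.2|) (fun z => |u z.1 z.2|) hM hM
    (fun _ => abs_nonneg _) (fun _ => abs_nonneg _) hum hum hweak hweak S m hm hS
  have e3 := hfo t ε w ht hε hwm.aemeasurable hw S m hm hS
  set G₁ : EuclideanSpace ℝ (Fin N) → ENNReal := fun x =>
    ∫⁻ y, ‖polyheatKernel d t (x - y)‖ₑ * ENNReal.ofReal |u₀ y| with hG₁
  set G₂ : EuclideanSpace ℝ (Fin N) → ENNReal := fun x =>
    ∫⁻ z, ‖polyheatKernel d (t - z.1) (x - z.2)‖ₑ *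
      ENNReal.ofReal (‖z.2‖ ^ α * |u z.1 z.2| ^ (p - 1) * |u z.1 z.2|)
        ∂((volume.restrict (Ioo 0 t)).prod volume) with hG₂
  set G₃ : EuclideanSpace ℝ (Fin N) → ENNReal := fun x =>
    ∫⁻ z, ‖polyheatKernel d (t - z.1) (x - z.2)‖ₑ * ENNReal.ofReal (z.1 ^ σ * |w z.2|)
      ∂((volume.restrict (Ioo 0 t)).prod volume) with hG₃
  have hpt : ∀ᵐ x, ‖u t x‖ₑ ≤ G₁ x + G₂ x + G₃ x := by
    filter_upwards [hsol.duhamel t ht, hsol.integrable_nonlinear t ht,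
      hsol.integrable_forcing t ht] with x hx hx2 hx3
    rw [hx]
    refine (enorm_add_le _ _).trans (add_le_add ((enorm_add_le _ _).trans (add_le_add ?_ ?_)) ?_)
    · refine (enorm_integral_le_lintegral_enorm _).trans (le_of_eq ?_)
      refine lintegral_congr fun y => ?_
      rw [enorm_mul, ← ofReal_norm (u₀ y), Real.norm_eq_abs]
    · have : ∫ s in Ioo 0 t, polyheat d (t - s) (fun y => ‖y‖ ^ α * |u s y| ^ p) x
          = ∫ z, polyheatKernel d (t - z.1) (x - z.2) * (‖z.2‖ ^ α * |u z.1 z.2| ^ p)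
            ∂((volume.restrict (Ioo 0 t)).prod volume) := (integral_prod _ hx2).symm
      rw [this]
      refine (enorm_integral_le_lintegral_enorm _).trans (le_of_eq ?_)
      refine lintegral_congr fun z => ?_
      have e : |u z.1 z.2| ^ p = |u z.1 z.2| ^ (p - 1) * |u z.1 z.2| := by
        rw [← Real.rpow_add_one' (abs_nonneg _) (by linarith [h.p_gt])]
        congr 1; ring
      rw [enorm_mul, e, mul_assoc,
        Real.enorm_of_nonneg (r := ‖z.2‖ ^ α * (|u z.1 z.2| ^ (p - 1) * |u z.1 z.2|))
          (by positivity)]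
    · have : ∫ s in Ioo 0 t, s ^ σ * polyheat d (t - s) w x
          = ∫ z, z.1 ^ σ * (polyheatKernel d (t - z.1) (x - z.2) * w z.2)
            ∂((volume.restrict (Ioo 0 t)).prod volume) := by
        rw [integral_prod _ hx3]
        refine integral_congr_ae (Eventually.of_forall fun s => ?_)
        exact (integral_const_mul _ _).symm
      rw [this]
      refine (enorm_integral_le_lintegral_enorm _).trans (le_of_eq ?_)
      have hpos : ∀ᵐ z : ℝ × EuclideanSpace ℝ (Fin N)
          ∂((volume.restrict (Ioo 0 t)).prod volume), 0 < z.1 :=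
        Measure.quasiMeasurePreserving_fst.ae
          ((ae_restrict_mem measurableSet_Ioo).mono fun s hs => hs.1)
      refine lintegral_congr_ae (hpos.mono fun z hz => ?_)
      simp only []
      rw [enorm_mul, enorm_mul, ← ofReal_norm (w z.2), Real.norm_eq_abs,
        Real.enorm_of_nonneg (Real.rpow_nonneg hz.le _),
        ENNReal.ofReal_mul (Real.rpow_nonneg hz.le _)]
      ring
  have hK : Measurable fun z : EuclideanSpace ℝ (Fin N) × (ℝ × EuclideanSpace ℝ (Fin N)) =>
      ‖polyheatKernel d (t - z.2.1) (z.1 - z.2.2)‖ₑ :=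
    ((measurable_polyheatKernel d).comp (by fun_prop : Measurable fun z :
      EuclideanSpace ℝ (Fin N) × (ℝ × EuclideanSpace ℝ (Fin N)) =>
        (t - z.2.1, z.1 - z.2.2))).enorm
  have hG₃m : AEMeasurable G₃ (volume.restrict S) := by
    refine AEMeasurable.lintegral_prod_right' (f := fun z : EuclideanSpace ℝ (Fin N) ×
      (ℝ × EuclideanSpace ℝ (Fin N)) => ‖polyheatKernel d (t - z.2.1) (z.1 - z.2.2)‖ₑ *
        ENNReal.ofReal (z.2.1 ^ σ * |w z.2.2|)) (hK.aemeasurable.mul ?_)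
    have : Measurable fun z : ℝ × EuclideanSpace ℝ (Fin N) => z.1 ^ σ := by fun_prop
    exact AEMeasurable.comp_snd (f := fun z : ℝ × EuclideanSpace ℝ (Fin N) =>
      ENNReal.ofReal (z.1 ^ σ * |w z.2|))
      (this.aemeasurable.mul hwm.aemeasurable.abs.comp_snd).ennreal_ofReal
  have hG₂m : AEMeasurable G₂ (volume.restrict S) := by
    refine AEMeasurable.lintegral_prod_right' (f := fun z : EuclideanSpace ℝ (Fin N) ×
      (ℝ × EuclideanSpace ℝ (Fin N)) => ‖polyheatKernel d (t - z.2.1) (z.1 - z.2.2)‖ₑ *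
        ENNReal.ofReal (‖z.2.2‖ ^ α * |u z.2.1 z.2.2| ^ (p - 1) * |u z.2.1 z.2.2|))
      (hK.aemeasurable.mul ?_)
    have : Measurable fun z : ℝ × EuclideanSpace ℝ (Fin N) => ‖z.2‖ ^ α := by fun_prop
    exact AEMeasurable.comp_snd (f := fun z : ℝ × EuclideanSpace ℝ (Fin N) =>
      ENNReal.ofReal (‖z.2‖ ^ α * |u z.1 z.2| ^ (p - 1) * |u z.1 z.2|))
      ((this.aemeasurable.mul (hum.pow_const _)).mul hum).ennreal_ofReal
  calc ∫⁻ x in S, ‖u t x‖ₑ ≤ ∫⁻ x in S, (G₁ x + G₂ x + G₃ x) :=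
        lintegral_mono_ae (ae_restrict_of_ae hpt)
    _ = (∫⁻ x in S, G₁ x) + (∫⁻ x in S, G₂ x) + ∫⁻ x in S, G₃ x := by
        rw [lintegral_add_right' _ hG₃m, lintegral_add_right' _ hG₂m]
    _ ≤ ENNReal.ofReal (K₁ * ε * m ^ (1 - 1 / q))
          + ENNReal.ofReal (K₂ * M ^ (p - 1) * M * m ^ (1 - 1 / q))
          + ENNReal.ofReal (K₃ * ε * m ^ (1 - 1 / q)) :=
        add_le_add (add_le_add e1 e2) e3
    _ ≤ _ := by
        rw [← ENNReal.ofReal_add (by positivity) (by positivity),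
          ← ENNReal.ofReal_add (by positivity) (by positivity)]
        refine ENNReal.ofReal_le_ofReal ?_
        rw [← add_mul, ← add_mul]
        gcongr
        have : 0 < M ^ (p - 1) * M := by positivity
        nlinarith [mul_pos hK₁0 this, mul_pos hK₃ this, mul_pos hK₂ hε]

/-- The difference of two solutions with the same data, both bounded by `M` in weak `L^q` before
time `t`. -/
theorem CriticalExponents.exists_isWeakLp_sub_le (h : CriticalExponents N d α p σ q r l) :
    ∃ K : ℝ, 0 < K ∧ ∀ (u₀ w : EuclideanSpace ℝ (Fin N) → ℝ)
      (u v : ℝ → EuclideanSpace ℝ (Fin N) → ℝ),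
      IsContinuousLpCurve (ENNReal.ofReal q) u → IsContinuousLpCurve (ENNReal.ofReal q) v →
      IsDuhamelSolution d α p (fun s => s ^ σ) u₀ w u →
      IsDuhamelSolution d α p (fun s => s ^ σ) u₀ w v →
      ∀ t M D : ℝ, 0 < t → 0 < M → 0 < D →
        (∀ s ∈ Ioo 0 t, IsWeakLp volume q M fun y => |u s y|) →
        (∀ s ∈ Ioo 0 t, IsWeakLp volume q M fun y => |v s y|) →
        (∀ s ∈ Ioo 0 t, IsWeakLp volume q D fun y => |u s y - v s y|) →
        IsWeakLp volume q (K * (2 * M) ^ (p - 1) * D) fun y => |u t y - v t y| := by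
  obtain ⟨C, hC⟩ := exists_polyheatBound h.dim_pos h.d_pos
  obtain ⟨K₂, hK₂, hnl⟩ := h.exists_nonlinear_le hC
  have hq0 : 0 < q := one_pos.trans h.q_gt
  have hp0 : 0 < p := one_pos.trans h.p_gt
  refine ⟨p * K₂, by positivity, ?_⟩
  intro u₀ w u v hu hv hsu hsv t M D ht hM hD hwu hwv hwd
  refine isWeakLp_of_setLIntegral_le hq0 (by positivity)
    ((hu.memLp t ht.le).1.sub (hv.memLp t ht.le).1).aemeasurable
    (fun s hs => measure_lt_abs_ne_top hq0 ((hu.memLp t ht.le).sub (hv.memLp t ht.le)) hs)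
    fun S m hm hS => ?_
  have hum := hu.aemeasurable_Ioo t
  have hvm := hv.aemeasurable_Ioo t
  have e2 := hnl t (2 * M) D (fun z => max |u z.1 z.2| |v z.1 z.2|)
    (fun z => |u z.1 z.2 - v z.1 z.2|) (by positivity) hD
    (fun _ => le_max_of_le_left (abs_nonneg _)) (fun _ => abs_nonneg _) (hum.abs.max hvm.abs)
    (hum.sub hvm).abs (fun s hs => IsWeakLp.max h.q_gt.le hM.le (hwu s hs) (hwv s hs))
    hwd S m hm hS
  have hpt : ∀ᵐ x, ‖u t x - v t x‖ₑ ≤ ENNReal.ofReal p *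
      ∫⁻ z, ‖polyheatKernel d (t - z.1) (x - z.2)‖ₑ *
        ENNReal.ofReal (‖z.2‖ ^ α * max |u z.1 z.2| |v z.1 z.2| ^ (p - 1) *
          |u z.1 z.2 - v z.1 z.2|) ∂((volume.restrict (Ioo 0 t)).prod volume) := by
    filter_upwards [hsu.duhamel t ht, hsv.duhamel t ht, hsu.integrable_nonlinear t ht,
      hsv.integrable_nonlinear t ht] with x hxu hxv hiu hiv
    have eu : ∫ s in Ioo 0 t, polyheat d (t - s) (fun y => ‖y‖ ^ α * |u s y| ^ p) x
          = ∫ z, polyheatKernel d (t - z.1) (x - z.2) * (‖z.2‖ ^ α * |u z.1 z.2| ^ p)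
            ∂((volume.restrict (Ioo 0 t)).prod volume) := (integral_prod _ hiu).symm
    have ev : ∫ s in Ioo 0 t, polyheat d (t - s) (fun y => ‖y‖ ^ α * |v s y| ^ p) x
          = ∫ z, polyheatKernel d (t - z.1) (x - z.2) * (‖z.2‖ ^ α * |v z.1 z.2| ^ p)
            ∂((volume.restrict (Ioo 0 t)).prod volume) := (integral_prod _ hiv).symm
    rw [hxu, hxv, eu, ev, add_sub_add_right_eq_sub, add_sub_add_left_eq_sub,
      ← integral_sub hiu hiv, ← lintegral_const_mul' _ _ ENNReal.ofReal_ne_top]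
    refine (enorm_integral_le_lintegral_enorm _).trans (lintegral_mono fun z => ?_)
    rw [← mul_sub, ← mul_sub, enorm_mul, mul_left_comm, ← ENNReal.ofReal_mul hp0.le]
    refine mul_le_mul_right ?_ _
    rw [← ofReal_norm, Real.norm_eq_abs]
    refine ENNReal.ofReal_le_ofReal ?_
    rw [abs_mul, abs_of_nonneg (Real.rpow_nonneg (norm_nonneg z.2) α)]
    calc _ ≤ ‖z.2‖ ^ α * (p * max |u z.1 z.2| |v z.1 z.2| ^ (p - 1)
          * |u z.1 z.2 - v z.1 z.2|) := by
          gcongr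
          exact abs_rpow_sub_abs_rpow_le h.p_gt.le _ _
      _ = _ := by ring
  refine (lintegral_mono_ae (ae_restrict_of_ae hpt)).trans ?_
  rw [lintegral_const_mul' _ _ ENNReal.ofReal_ne_top]
  refine (mul_le_mul_right e2 _).trans (le_of_eq ?_)
  rw [← ENNReal.ofReal_mul hp0.le]
  congr 1
  ring

/-- Continuity in time: an improvement of the constant from `4 δ` to `δ` propagates. -/
theorem IsContinuousLpCurve.isWeakLp_of_improvement {δ : ℝ} (hq : 1 ≤ q) (hδ : 0 < δ)
    {u : ℝ → EuclideanSpace ℝ (Fin N) → ℝ} (hu : IsContinuousLpCurve (ENNReal.ofReal q) u)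
    (h0 : IsWeakLp volume q δ fun y => |u 0 y|)
    (hstep : ∀ t, 0 < t → (∀ s ∈ Ioo 0 t, IsWeakLp volume q (4 * δ) fun y => |u s y|) →
      IsWeakLp volume q δ fun y => |u t y|) :
    ∀ t, 0 ≤ t → IsWeakLp volume q δ fun y => |u t y| := by
  by_contra! hcon
  have hq0 : 0 < q := by linarith
  have hmono : ∀ {s}, (IsWeakLp volume q δ fun y => |u s y|) →
      IsWeakLp volume q (4 * δ) fun y => |u s y| := fun hs =>
    hs.mono hq0.le hδ.le (by linarith) fun _ => le_rfl
  -- `T` is the first time at which the bound by `δ` could fail.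
  set B := {t | 0 ≤ t ∧ ¬ IsWeakLp volume q δ fun y => |u t y|} with hB
  have hBne : B.Nonempty := hcon
  have hBbdd : BddBelow B := ⟨0, fun t ht => ht.1⟩
  set T := sInf B with hT
  have hT0 : 0 ≤ T := le_csInf hBne fun t ht => ht.1
  have hbelow : ∀ s, 0 ≤ s → s < T → IsWeakLp volume q δ fun y => |u s y| := by
    intro s hs hsT
    by_contra hns
    exact absurd (csInf_le hBbdd ⟨hs, hns⟩) (not_le.2 hsT)
  have hPT : IsWeakLp volume q δ fun y => |u T y| := by
    rcases hT0.eq_or_lt with h | h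
    · rwa [← h]
    · exact hstep T h fun s hs => hmono (hbelow s hs.1.le hs.2)
  have hnear : ∀ᶠ s in 𝓝[Ici 0] T,
      eLpNorm (fun x => u s x - u T x) (ENNReal.ofReal q) volume < ENNReal.ofReal δ :=
    (hu.tendsto T hT0).eventually_lt_const (by simpa using hδ)
  obtain ⟨η, hη, hball⟩ := Metric.mem_nhdsWithin_iff.1 hnear
  have hright : ∀ s, T ≤ s → s < T + η → IsWeakLp volume q (4 * δ) fun y => |u s y| := by
    intro s hTs hs
    have hs0 : 0 ≤ s := hT0.trans hTs
    have hlt : eLpNorm (fun x => u s x - u T x) (ENNReal.ofReal q) volume < ENNReal.ofReal δ :=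
      hball ⟨by rw [Metric.mem_ball, Real.dist_eq, abs_of_nonneg (by linarith)]; linarith, hs0⟩
    have hd := isWeakLp_of_eLpNorm_le hq0 hδ.le
      ((hu.memLp s hs0).1.sub (hu.memLp T hT0).1) hlt.le
    simpa using hd.abs_add hq hδ.le hPT
  obtain ⟨b, hb, hbT⟩ := exists_lt_of_csInf_lt hBne (show sInf B < T + η by linarith)
  refine hb.2 ?_
  have hTb : T ≤ b := csInf_le hBbdd hb
  rcases hTb.eq_or_lt with h | h
  · rwa [← h]
  · refine hstep b (hT0.trans_lt h) fun s hs => ?_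
    rcases lt_or_ge s T with hsT | hsT
    · exact hmono (hbelow s hs.1.le hsT)
    · exact hright s hsT (hs.2.trans hbT)

end Solutions

theorem ae_eq_zero_of_isWeakLp {X : Type*} [MeasurableSpace X] {μ : Measure X} {q : ℝ}
    (hq : 0 < q) {A : ℕ → ℝ} (hA : Tendsto A atTop (𝓝 0)) {f : X → ℝ}
    (hf : ∀ n, IsWeakLp μ q (A n) fun x => |f x|) : ∀ᵐ x ∂μ, f x = 0 := by
  have hlevel : ∀ s, 0 < s → μ {x | s < |f x|} = 0 := by
    intro s hs
    have hlim : Tendsto (fun n => ENNReal.ofReal ((A n / s) ^ q)) atTop (𝓝 0) := by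
      have h1 := (hA.div_const s).rpow_const (p := q) (Or.inr hq.le)
      rw [zero_div, Real.zero_rpow hq.ne'] at h1
      simpa using ENNReal.tendsto_ofReal h1
    exact le_antisymm (ge_of_tendsto' hlim fun n => hf n s hs) zero_le
  have hall : ∀ᵐ x ∂μ, ∀ n : ℕ, ¬ (1 / ((n : ℝ) + 1) < |f x|) :=
    ae_all_iff.2 fun n => measure_eq_zero_iff_ae_notMem.1 (hlevel _ (by positivity))
  filter_upwards [hall] with x hx
  by_contra hne
  obtain ⟨n, hn⟩ := exists_nat_one_div_lt (abs_pos.2 hne)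
  exact hx n hn

/-- Curves which agree almost everywhere in space at every time agree almost everywhere in space
and time. -/
theorem ae_prod_eq_of_forall_ae_eq {X Y : Type*} [MeasurableSpace X] [MeasurableSpace Y]
    {μ : Measure X} {ν : Measure Y} [SFinite μ] [SFinite ν] {f g : X × Y → ℝ}
    (hf : AEStronglyMeasurable f (μ.prod ν)) (hg : AEStronglyMeasurable g (μ.prod ν))
    (h : ∀ᵐ x ∂μ, ∀ᵐ y ∂ν, f (x, y) = g (x, y)) : ∀ᵐ z ∂(μ.prod ν), f z = g z := by
  have hmk : ∀ᵐ z ∂(μ.prod ν), hf.mk f z = hg.mk g z := by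
    have hms : MeasurableSet {z | hf.mk f z = hg.mk g z} :=
      measurableSet_eq_fun hf.stronglyMeasurable_mk.measurable hg.stronglyMeasurable_mk.measurable
    rw [Measure.ae_prod_iff_ae_ae hms]
    filter_upwards [h, Measure.ae_ae_of_ae_prod hf.ae_eq_mk, Measure.ae_ae_of_ae_prod hg.ae_eq_mk]
      with x h1 h2 h3
    filter_upwards [h1, h2, h3] with y h1 h2 h3
    rw [← h2, ← h3, h1]
  filter_upwards [hmk, hf.ae_eq_mk, hg.ae_eq_mk] with z h1 h2 h3
  rw [h2, h3, h1]

/-! ### Uniqueness -/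

theorem mainTheorem3 (N : ℕ) (d α p σ pc l : ℝ)
    (hd : (0 < d ∧ d < 1) ∨ ∃ k : ℕ, 1 ≤ k ∧ d = k)
    (hα : 0 < -α ∧ -α < 2 * d) (hN : 2 * d < N)
    (hp : (N + α) / (N - 2 * d) < p)
    (hσ : -1 < σ ∧ σ < 0)
    (hpc : pc = N * (p - 1) / (2 * d + α))
    (hl : l = N * pc / (N + 2 * (σ + 1) * d * pc)) :
    ∃ ε : ℝ, 0 < ε ∧
      ∀ u₀ w : EuclideanSpace ℝ (Fin N) → ℝ,
        MemLp u₀ (ENNReal.ofReal pc) volume → MemLp w (ENNReal.ofReal l) volume →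
        eLpNorm u₀ (ENNReal.ofReal pc) volume + eLpNorm w (ENNReal.ofReal l) volume
          < ENNReal.ofReal ε →
        ∀ u v : ℝ → EuclideanSpace ℝ (Fin N) → ℝ,
          IsContinuousLpCurve (ENNReal.ofReal pc) u →
          IsContinuousLpCurve (ENNReal.ofReal pc) v →
          IsDuhamelSolution d α p (fun s => s ^ σ) u₀ w u →
          IsDuhamelSolution d α p (fun s => s ^ σ) u₀ w v →
          ∀ᵐ z : ℝ × EuclideanSpace ℝ (Fin N) ∂((volume.restrict (Ioi (0 : ℝ))).prod volume),
            u z.1 z.2 = v z.1 z.2 := by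
  have hd0 : 0 < d := by
    rcases hd with h | ⟨k, hk, rfl⟩
    · exact h.1
    · exact_mod_cast hk
  have h := criticalExponents hd0 hα hN hp hσ hpc hl
  have hq0 : 0 < pc := one_pos.trans h.q_gt
  have hl0 : 0 < l := one_pos.trans h.l_gt
  have hκ : 0 < p - 1 := sub_pos.2 h.p_gt
  obtain ⟨K, hK, hbound⟩ := h.exists_isWeakLp_le
  obtain ⟨K', hK', hdiff⟩ := h.exists_isWeakLp_sub_le
  -- With `δ` small, `δ` bounds the nonlinear term of a curve of size `4 δ` by `δ / 2`, and the
  -- difference operator contracts by `1 / 2` on curves of size `δ`.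
  obtain ⟨δ, hδ, hδK, hδK'⟩ : ∃ δ : ℝ, 0 < δ ∧ K * ((4 * δ) ^ (p - 1) * (4 * δ)) ≤ δ / 2 ∧
      K' * (2 * δ) ^ (p - 1) ≤ 1 / 2 := by
    set c := min (1 / (8 * K)) (1 / (2 * K')) with hc
    have hc0 : 0 < c := by positivity
    have hcK : c ≤ 1 / (8 * K) := min_le_left _ _
    have hcK' : c ≤ 1 / (2 * K') := min_le_right _ _
    rw [le_div_iff₀ (by positivity)] at hcK hcK'
    have h4 : 4 * (c ^ (1 / (p - 1)) / 4) = c ^ (1 / (p - 1)) := by ring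
    have hpow : (c ^ (1 / (p - 1))) ^ (p - 1) = c := by
      rw [← Real.rpow_mul hc0.le, one_div_mul_cancel hκ.ne', Real.rpow_one]
    refine ⟨c ^ (1 / (p - 1)) / 4, by positivity, ?_, ?_⟩
    · rw [h4, hpow]
      have : 0 < c ^ (1 / (p - 1)) := by positivity
      nlinarith
    · have hpos : 0 < c ^ (1 / (p - 1)) := by positivity
      have : (2 * (c ^ (1 / (p - 1)) / 4)) ^ (p - 1) ≤ c :=
        (Real.rpow_le_rpow (by positivity) (by linarith) hκ.le).trans hpow.le
      nlinarith
  refine ⟨min δ (δ / (2 * K)), by positivity, ?_⟩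
  intro u₀ w hu₀ hw hsmall u v hu hv hsu hsv
  set ε := min δ (δ / (2 * K)) with hε
  have hε0 : 0 < ε := by positivity
  have hεK : K * ε ≤ δ / 2 := by
    have : ε ≤ δ / (2 * K) := min_le_right _ _
    rw [le_div_iff₀ (by positivity)] at this
    linarith
  have hwu₀ : IsWeakLp volume pc ε fun y => |u₀ y| :=
    isWeakLp_of_eLpNorm_le hq0 hε0.le hu₀.1 (le_self_add.trans hsmall.le)
  have hww : IsWeakLp volume l ε fun y => |w y| :=
    isWeakLp_of_eLpNorm_le hl0 hε0.le hw.1 (le_add_self.trans hsmall.le)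
  -- Smallness of the data is inherited by every solution for all times, in weak `L^pc` only:
  -- no such bound is claimed in `L^pc` itself.
  have hglobal : ∀ u : ℝ → EuclideanSpace ℝ (Fin N) → ℝ,
      IsContinuousLpCurve (ENNReal.ofReal pc) u →
      IsDuhamelSolution d α p (fun s => s ^ σ) u₀ w u →
      ∀ t, 0 ≤ t → IsWeakLp volume pc δ fun y => |u t y| := by
    intro u hu hsu
    refine hu.isWeakLp_of_improvement h.q_gt.le hδ ?_ fun t ht hs => ?_
    · refine isWeakLp_of_eLpNorm_le hq0 hδ.le (hu.memLp 0 le_rfl).1 ?_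
      rw [eLpNorm_congr_ae hsu.initial]
      exact (le_self_add.trans hsmall.le).trans (ENNReal.ofReal_le_ofReal (min_le_left _ _))
    · refine (hbound ε u₀ w u hε0 hu₀.1 hw.1 hwu₀ hww hu hsu t (4 * δ) ht (by positivity)
        hs).mono hq0.le (by positivity) ?_ fun _ => le_rfl
      rw [mul_add]
      linarith
  have hWu := hglobal u hu hsu
  have hWv := hglobal v hv hsv
  have hiter : ∀ n : ℕ, ∀ t, 0 < t →
      IsWeakLp volume pc (4 * δ * (1 / 2) ^ n) fun y => |u t y - v t y| := by
    intro n
    induction n with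
    | zero =>
      intro t ht
      simpa using (hWu t ht.le).abs_sub h.q_gt.le hδ.le (hWv t ht.le)
    | succ n ih =>
      intro t ht
      refine (hdiff u₀ w u v hu hv hsu hsv t δ (4 * δ * (1 / 2) ^ n) ht hδ (by positivity)
        (fun s hs => hWu s hs.1.le) (fun s hs => hWv s hs.1.le) fun s hs => ih s hs.1).mono
        hq0.le (by positivity) ?_ fun _ => le_rfl
      rw [pow_succ]
      have : 0 < 4 * δ * (1 / 2 : ℝ) ^ n := by positivity
      nlinarith
  have hlim : Tendsto (fun n : ℕ => 4 * δ * (1 / 2 : ℝ) ^ n) atTop (𝓝 0) := by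
    simpa using (tendsto_pow_atTop_nhds_zero_of_lt_one (r := (1 / 2 : ℝ)) (by norm_num)
      (by norm_num)).const_mul (4 * δ)
  refine ae_prod_eq_of_forall_ae_eq hu.aestronglyMeasurable hv.aestronglyMeasurable ?_
  refine (ae_restrict_mem measurableSet_Ioi).mono fun t ht => ?_
  filter_upwards [ae_eq_zero_of_isWeakLp hq0 hlim fun n => hiter n t ht] with x hx
  exact sub_eq_zero.1 hx
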